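/- Let $(W,S)$ be a Coxeter system with length function $\ell$, and let $\ast$ be an automorphism of $W$ with $\ast^2=\mathrm{id}$ and $S^\ast=S$. Put $\mathbf I_\ast=\{w\in W : w^\ast=w^{-1}\}$. For $s\in S$ and $w\in\mathbf I_\ast$ let $s\ltimes w=sw$ if $sw=ws^\ast$, and $s\ltimes w=sws^\ast$ otherwise. An $\mathbf I_\ast$-expression of $z\in\mathbf I_\ast$ is a sequence $(s_{1},\dots,s_{k})$ in $S$ with $z=s_{1}\ltimes(s_{2}\ltimes\cdots\ltimes(s_{k}\ltimes 1)\cdots)$; it is reduced if $k$ is minimal. Let $u$ be an indeterminate, and let $\mathcal H_u$ be the associative unital $\mathbb Q(u)$-algebra generated by elements $T_w$ ($w\in W$) with relations $T_1=1$, $T_wT_{w'}=T_{ww'}$ if $\ell(ww')=\ell(w)+\ell(w')$, and $(T_s+1)(T_s-u^2)=0$ for $s\in S$. Let $M_u$ be the $\mathbb Q(u)$-vector space with basis $\{a_z : z\in\mathbf I_\ast\}$. There is a unique $\mathcal H_u$-module structure on $M_u$ extending its $\mathbb Q(u)$-structure such that, for all $s\in S$ and $w\in\mathbf I_\ast$,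 $$T_sa_w=\begin{cases} ua_w+(u+1)a_{sw} & \text{if } sw=ws^\ast>w,\\ (u^2-u-1)a_w+(u^2-u)a_{sw} & \text{if } sw=ws^\ast<w,\\ a_{sws^\ast} & \text{if } sw\ne ws^\ast>w,\\ (u^2-1)a_w+u^2a_{sws^\ast} & \text{if } sw\ne ws^\ast<w,\end{cases}$$ where $<$ is the Bruhat order (so that $sw>w$ if and only if $\ell(sw)>\ell(w)$, and $\ell(sw)=\ell(ws^\ast)$ for $w\in\mathbf I_\ast$). Equip $M_u$ with it. Inside $\mathbb Q(u)$ let $\mathcal A=\mathbb Z[u,u^{-1}]$, $\mathcal A_{-1}=\mathbb Z[u,u^{-1},(u+1)^{-1}]$ and $\mathcal A_{\pm1}=\mathbb Z[u,u^{-1},(u+1)^{-1},(u-1)^{-1}]$. Let $M_{\mathcal A,u}\subseteq M_u$ be the $\mathcal A$-submodule generated by $\{a_z : z\in\mathbf I_\ast\}$; it is stable under all $T_w$. Put $M_{\mathcal A_{-1},u}=\mathcal A_{-1}\otimes_{\mathcal A}M_{\mathcal A,u}$ and $M_{\mathcal A_{\pm1},u}=\mathcal A_{\pm1}\otimes_{\mathcal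 A}M_{\mathcal A,u}$. For each $z\in\mathbf I_\ast$ fix a reduced $\mathbf I_\ast$-expression $(s_1,\dots,s_k)$ of $z$ and put $\sigma_z=s_1s_2\cdots s_k\in W$. Then the family $(T_{\sigma_z}a_1)_{z\in\mathbf I_\ast}$ is a basis of $M_u$ over $\mathbb Q(u)$; the family $(1\otimes T_{\sigma_z}a_1)_{z\in\mathbf I_\ast}$ is a basis of $M_{\mathcal A_{-1},u}$ over $\mathcal A_{-1}$ and, likewise, of $M_{\mathcal A_{\pm1},u}$ over $\mathcal A_{\pm1}$; and for every field $K$ and every ring homomorphism $\phi:\mathcal A_{-1}\to K$, the family $(1\otimes 1\otimes T_{\sigma_z}a_1)_{z\in\mathbf I_\ast}$ is a basis over $K$ of $K\otimes_{\mathcal A_{-1}}M_{\mathcal A_{-1},u}$ (where $K$ is an $\mathcal A_{-1}$-module through $\phi$, so that $u$ acts by $\lambda=\phi(u)$). -/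

import Mathlib

open scoped TensorProduct

universe u v w

/-! ## The Iwahori--Hecke algebra -/

/-- The defining relations of the Iwahori--Hecke algebra with parameter `q`, on generators
`T_w` (`w ∈ W`): `T_1 = 1`, `T_w T_w' = T_{ww'}` whenever `ℓ(ww') = ℓ(w) + ℓ(w')`, and
`(T_s + 1)(T_s - q) = 0` for every simple reflection `s`. -/
inductive HeckeRel {B : Type u} {W : Type v} [Group W] {M : CoxeterMatrix B}
    (cs : CoxeterSystem M W) {R : Type w} [CommRing R] (q : R) :
    FreeAlgebra R W → FreeAlgebra R W → Prop
  | one : HeckeRel cs q (FreeAlgebra.ι R (1 : W)) 1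
  | mul (x y : W) (h : cs.length (x * y) = cs.length x + cs.length y) :
      HeckeRel cs q (FreeAlgebra.ι R x * FreeAlgebra.ι R y) (FreeAlgebra.ι R (x * y))
  | quad (i : B) :
      HeckeRel cs q
        ((FreeAlgebra.ι R (cs.simple i) + 1) *
          (FreeAlgebra.ι R (cs.simple i) - algebraMap R (FreeAlgebra R W) q)) 0

/-- The Iwahori--Hecke algebra over `R` with parameter `q` of a Coxeter system. -/
abbrev HeckeAlgebra {B : Type u} {W : Type v} [Group W] {M : CoxeterMatrix B}
    (cs : CoxeterSystem M W) {R : Type w} [CommRing R] (q : R) : Type (max v w) :=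
  RingQuot (HeckeRel cs q)

/-- The standard element `T_x` of the Iwahori--Hecke algebra. -/
noncomputable def HeckeAlgebra.T {B : Type u} {W : Type v} [Group W] {M : CoxeterMatrix B}
    (cs : CoxeterSystem M W) {R : Type w} [CommRing R] (q : R) (x : W) : HeckeAlgebra cs q :=
  RingQuot.mkAlgHom R (HeckeRel cs q) (FreeAlgebra.ι R x)

/-! ## Twisted involutions and `I_*`-expressions -/

/-- An automorphism `*` of the group `W` of order at most `2` with `S^* = S`, where `S` is the
set of simple reflections. -/
structure CoxeterInvolution {B : Type u} {W : Type v} [Group W] {M : CoxeterMatrix B}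
    (cs : CoxeterSystem M W) where
  /-- The underlying group automorphism. -/
  toMulEquiv : W ≃* W
  star_star : ∀ x : W, toMulEquiv (toMulEquiv x) = x
  image_simple : toMulEquiv '' Set.range cs.simple = Set.range cs.simple

namespace CoxeterInvolution

variable {B : Type u} {W : Type v} [Group W] {M : CoxeterMatrix B} {cs : CoxeterSystem M W}

/-- The set `I_*` of twisted involutions: the `x ∈ W` with `x^* = x⁻¹`. -/
abbrev TwistedInv (θ : CoxeterInvolution cs) : Type v := {x : W // θ.toMulEquiv x = x⁻¹}

/-- The identity of `W`, as a twisted involution. -/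
def one (θ : CoxeterInvolution cs) : θ.TwistedInv := ⟨1, by simp⟩

/-- `s` and `x` satisfy `s x = x s^*`. -/
def Comm (θ : CoxeterInvolution cs) (i : B) (x : W) : Prop :=
  cs.simple i * x = x * θ.toMulEquiv (cs.simple i)

open Classical in
/-- The operation `s ⋉ x` on `I_*`: it is `s x` if `s x = x s^*`, and `s x s^*` otherwise. -/
noncomputable def ltimes (θ : CoxeterInvolution cs) (i : B) (x : θ.TwistedInv) :
    θ.TwistedInv :=
  if h : θ.Comm i x.1 then
    ⟨cs.simple i * x.1, by
      have hs : (θ.toMulEquiv (cs.simple i))⁻¹ = θ.toMulEquiv (cs.simple i) := by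
        rw [← map_inv, cs.inv_simple]
      rw [map_mul, x.2, show cs.simple i * x.1 = x.1 * θ.toMulEquiv (cs.simple i) from h,
        mul_inv_rev, hs]⟩
  else
    ⟨cs.simple i * x.1 * θ.toMulEquiv (cs.simple i), by
      have hs : (θ.toMulEquiv (cs.simple i))⁻¹ = θ.toMulEquiv (cs.simple i) := by
        rw [← map_inv, cs.inv_simple]
      rw [map_mul, map_mul, x.2, θ.star_star, mul_inv_rev, mul_inv_rev, hs, cs.inv_simple,
        mul_assoc]⟩

/-- The twisted involution `s_{i_1} ⋉ (s_{i_2} ⋉ ⋯ ⋉ (s_{i_k} ⋉ 1))` given by a word. -/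
noncomputable def exprProd (θ : CoxeterInvolution cs) (ω : List B) : θ.TwistedInv :=
  ω.foldr θ.ltimes θ.one

/-- `ω` is a reduced `I_*`-expression for `z`: an `I_*`-expression of minimal length. -/
def IsReducedExpr (θ : CoxeterInvolution cs) (ω : List B) (z : θ.TwistedInv) : Prop :=
  θ.exprProd ω = z ∧ ∀ ω' : List B, θ.exprProd ω' = z → ω.length ≤ ω'.length

end CoxeterInvolution

/-! ## Coefficient rings, as subrings of `ℚ(u)` -/

/-- The indeterminate `u` of the field `ℚ(u)`. -/
noncomputable abbrev uVar : RatFunc ℚ := RatFunc.X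

/-- `𝒜 = ℤ[u, u⁻¹]`. -/
noncomputable def ringA : Subring (RatFunc ℚ) := Subring.closure {uVar, uVar⁻¹}

/-- `𝒜₋₁ = ℤ[u, u⁻¹, (u+1)⁻¹]`. -/
noncomputable def ringAneg : Subring (RatFunc ℚ) :=
  Subring.closure {uVar, uVar⁻¹, (uVar + 1)⁻¹}

/-- `𝒜_{±1} = ℤ[u, u⁻¹, (u+1)⁻¹, (u-1)⁻¹]`. -/
noncomputable def ringApm : Subring (RatFunc ℚ) :=
  Subring.closure {uVar, uVar⁻¹, (uVar + 1)⁻¹, (uVar - 1)⁻¹}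

theorem ringA_le_ringAneg : ringA ≤ ringAneg :=
  Subring.closure_mono (by intro x; simp only [Set.mem_insert_iff, Set.mem_singleton_iff]; tauto)

theorem ringA_le_ringApm : ringA ≤ ringApm :=
  Subring.closure_mono (by intro x; simp only [Set.mem_insert_iff, Set.mem_singleton_iff]; tauto)

/-- `𝒜₋₁` is an `𝒜`-algebra through the inclusion. -/
noncomputable instance instAlgebraAneg : Algebra ringA ringAneg :=
  (Subring.inclusion ringA_le_ringAneg).toAlgebra

/-- `𝒜_{±1}` is an `𝒜`-algebra through the inclusion. -/
noncomputable instance instAlgebraApm : Algebra ringA ringApm :=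
  (Subring.inclusion ringA_le_ringApm).toAlgebra

/-! ## The involution module -/

namespace CoxeterInvolution

variable {B : Type u} {W : Type v} [Group W] {M : CoxeterMatrix B} {cs : CoxeterSystem M W}

/-- The `ℚ(u)`-vector space `M_u` with basis `a_z`, `z ∈ I_*`. -/
abbrev Mu (θ : CoxeterInvolution cs) : Type v := θ.TwistedInv →₀ RatFunc ℚ

/-- The basis vector `a_z` of `M_u`. -/
noncomputable def a (θ : CoxeterInvolution cs) (z : θ.TwistedInv) : θ.Mu := Finsupp.single z 1

/-- The algebra homomorphism `ρ` is an `ℋ_u`-module structure on the `ℚ(u)`-space `M_u` with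
* `T_s a_x = u a_x + (u+1) a_{sx}` if `sx = xs^* > x`,
* `T_s a_x = (u²-u-1) a_x + (u²-u) a_{sx}` if `sx = xs^* < x`,
* `T_s a_x = a_{sxs^*}` if `sx ≠ xs^* > x`,
* `T_s a_x = (u²-1) a_x + u² a_{sxs^*}` if `sx ≠ xs^* < x`.
The comparisons are expressed through the length of `sx`; for a twisted involution `x` one has
`ℓ(sx) = ℓ(xs^*)`. -/
structure IsInvolutionModule (θ : CoxeterInvolution cs)
    (ρ : HeckeAlgebra cs (uVar ^ 2) →ₐ[RatFunc ℚ] Module.End (RatFunc ℚ) θ.Mu) : Prop where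
  comm_up : ∀ (i : B) (x : θ.TwistedInv), θ.Comm i x.1 →
    cs.length x.1 < cs.length (cs.simple i * x.1) →
    ρ (HeckeAlgebra.T cs (uVar ^ 2) (cs.simple i)) (θ.a x) =
      uVar • θ.a x + (uVar + 1) • θ.a (θ.ltimes i x)
  comm_down : ∀ (i : B) (x : θ.TwistedInv), θ.Comm i x.1 →
    cs.length (cs.simple i * x.1) < cs.length x.1 →
    ρ (HeckeAlgebra.T cs (uVar ^ 2) (cs.simple i)) (θ.a x) =
      (uVar ^ 2 - uVar - 1) • θ.a x + (uVar ^ 2 - uVar) • θ.a (θ.ltimes i x)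
  not_comm_up : ∀ (i : B) (x : θ.TwistedInv), ¬ θ.Comm i x.1 →
    cs.length x.1 < cs.length (cs.simple i * x.1) →
    ρ (HeckeAlgebra.T cs (uVar ^ 2) (cs.simple i)) (θ.a x) = θ.a (θ.ltimes i x)
  not_comm_down : ∀ (i : B) (x : θ.TwistedInv), ¬ θ.Comm i x.1 →
    cs.length (cs.simple i * x.1) < cs.length x.1 →
    ρ (HeckeAlgebra.T cs (uVar ^ 2) (cs.simple i)) (θ.a x) =
      (uVar ^ 2 - 1) • θ.a x + uVar ^ 2 • θ.a (θ.ltimes i x)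

/-- The `𝒜`-submodule `M_𝒜` of `M_u` generated by the `a_z`. -/
noncomputable def MA (θ : CoxeterInvolution cs) : Submodule ringA θ.Mu :=
  Submodule.span ringA (Set.range θ.a)

theorem smul_mem_MA (θ : CoxeterInvolution cs) {c : RatFunc ℚ} (hc : c ∈ ringA) {m : θ.Mu}
    (hm : m ∈ θ.MA) : c • m ∈ θ.MA :=
  θ.MA.smul_mem (⟨c, hc⟩ : ringA) hm

theorem a_mem_MA (θ : CoxeterInvolution cs) (z : θ.TwistedInv) : θ.a z ∈ θ.MA :=
  Submodule.subset_span ⟨z, rfl⟩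

theorem IsInvolutionModule.simple_mem {θ : CoxeterInvolution cs}
    {ρ : HeckeAlgebra cs (uVar ^ 2) →ₐ[RatFunc ℚ] Module.End (RatFunc ℚ) θ.Mu}
    (hρ : θ.IsInvolutionModule ρ) (i : B) {m : θ.Mu} (hm : m ∈ θ.MA) :
    ρ (HeckeAlgebra.T cs (uVar ^ 2) (cs.simple i)) m ∈ θ.MA := by
  have hu : uVar ∈ ringA := Subring.subset_closure (by simp)
  induction hm using Submodule.span_induction with
  | mem y hy =>
    obtain ⟨x, rfl⟩ := hy
    have hx := θ.a_mem_MA x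
    have hl := θ.a_mem_MA (θ.ltimes i x)
    rcases (cs.length_simple_mul_ne x.1 i).lt_or_gt with h | h <;> by_cases hc : θ.Comm i x.1
    · rw [hρ.comm_down i x hc h]
      exact add_mem (θ.smul_mem_MA (sub_mem (sub_mem (pow_mem hu 2) hu) (one_mem _)) hx)
        (θ.smul_mem_MA (sub_mem (pow_mem hu 2) hu) hl)
    · rw [hρ.not_comm_down i x hc h]
      exact add_mem (θ.smul_mem_MA (sub_mem (pow_mem hu 2) (one_mem _)) hx)
        (θ.smul_mem_MA (pow_mem hu 2) hl)
    · rw [hρ.comm_up i x hc h]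
      exact add_mem (θ.smul_mem_MA hu hx) (θ.smul_mem_MA (add_mem hu (one_mem _)) hl)
    · rw [hρ.not_comm_up i x hc h]
      exact hl
  | zero => rw [map_zero]; exact zero_mem _
  | add y z _ _ hy hz => rw [map_add]; exact add_mem hy hz
  | smul c y _ hy =>
    have : c • y = (c : RatFunc ℚ) • y := rfl
    rw [this, map_smul]
    exact θ.smul_mem_MA c.2 hy

/-- `M_𝒜` is stable under all `T_x`. -/
theorem IsInvolutionModule.T_mem {θ : CoxeterInvolution cs}
    {ρ : HeckeAlgebra cs (uVar ^ 2) →ₐ[RatFunc ℚ] Module.End (RatFunc ℚ) θ.Mu}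
    (hρ : θ.IsInvolutionModule ρ) (x : W) {m : θ.Mu} (hm : m ∈ θ.MA) :
    ρ (HeckeAlgebra.T cs (uVar ^ 2) x) m ∈ θ.MA := by
  induction hn : cs.length x generalizing x with
  | zero =>
    rw [cs.length_eq_zero_iff] at hn
    have h1 : HeckeAlgebra.T cs (uVar ^ 2) (1 : W) = 1 := by
      rw [HeckeAlgebra.T, RingQuot.mkAlgHom_rel _ (HeckeRel.one), map_one]
    rw [hn, h1, map_one]
    exact hm
  | succ n ih =>
    have hx1 : x ≠ 1 := by
      rintro rfl
      simp at hn
    obtain ⟨i, hi⟩ := cs.exists_leftDescent_of_ne_one hx1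
    rw [cs.isLeftDescent_iff] at hi
    have hlen : cs.length (cs.simple i * (cs.simple i * x)) =
        cs.length (cs.simple i) + cs.length (cs.simple i * x) := by
      rw [cs.simple_mul_simple_cancel_left, cs.length_simple]
      omega
    have hT : HeckeAlgebra.T cs (uVar ^ 2) x =
        HeckeAlgebra.T cs (uVar ^ 2) (cs.simple i) *
          HeckeAlgebra.T cs (uVar ^ 2) (cs.simple i * x) := by
      have := RingQuot.mkAlgHom_rel (RatFunc ℚ) (HeckeRel.mul (cs := cs) (q := uVar ^ 2) _ _ hlen)
      rw [cs.simple_mul_simple_cancel_left, map_mul] at this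
      exact this.symm
    rw [hT, map_mul]
    exact hρ.simple_mem i (ih _ (by omega))

/-- The element `T_x a_1` of `M_𝒜`. -/
noncomputable def IsInvolutionModule.Ta {θ : CoxeterInvolution cs}
    {ρ : HeckeAlgebra cs (uVar ^ 2) →ₐ[RatFunc ℚ] Module.End (RatFunc ℚ) θ.Mu}
    (hρ : θ.IsInvolutionModule ρ) (x : W) : θ.MA :=
  ⟨ρ (HeckeAlgebra.T cs (uVar ^ 2) x) (θ.a θ.one), hρ.T_mem x (θ.a_mem_MA θ.one)⟩

end CoxeterInvolution

/-- The family `b` is a basis of the `R`-module `N`. -/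
def IsBasisFamily (R : Type*) {N ι : Type*} [CommRing R] [AddCommGroup N] [Module R N]
    (b : ι → N) : Prop :=
  LinearIndependent R b ∧ Submodule.span R (Set.range b) = ⊤

/-! The family is triangular with respect to the basis `a_z`. Along a reduced expression every step
goes up: a non-commuting step sends `a_w` to the next basis vector, a commuting one sends it to `u
a_w` plus `u + 1` times the next one. So `T_σ a_1` is `(u + 1)^n a_z`, with `n` the number of
commuting steps, plus terms of lower rank with coefficients in `ringA`
(`exists_prod_heckeOp_apply`). Once `u + 1` is invertible the diagonal consists of units and the
family is a basis (`IsTriangular.isBasisFamily`); triangularity survives base change. This needs a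
rank that does not depend on the descending path (`rank_of_not_up`), and the fact that a reduced
expression is a reduced word (`isReduced_of_length_eq_rank`), so that `T_σ` is a product of
operators `T_s`.

The module structure exists because the operators `heckeOp` satisfy the quadratic and braid
relations; Matsumoto's theorem (`prod_map_eq_of_isReduced`) then defines `T_x`. For a braid
relation, the kernel of the difference of the two alternating products is stable under both
operators, so descent reduces to `a_d` with `d` having neither `i` nor `j` as a descent. The orbit
above `d` consists of two increasing chains with a common top, and commuting steps occur only at
their ends (`exists_orbit_top`). The differences `D k` of the alternating products with `k` factors,
applied to `a_d`, satisfy a three-term recursion. The orbit supplies `D m = 0` directly, or a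
relation between neighbouring terms that reflects `D 0 = 0` into `D m = 0`
(`eq_zero_of_reflection`).

The same orbits show that the rank is well defined. Their analysis rests on the cocycle property of
left inversions (`isLeftInversion_mul_iff`), applied to twisted double cosets of rank two parabolic
subgroups. -/

/-! ## Inversions -/

namespace CoxeterSystem

variable {B : Type u} {W : Type v} [Group W] {M : CoxeterMatrix B} (cs : CoxeterSystem M W)

open Classical in
/-- The action of a simple reflection on `W × ℤ/2` by conjugation, changing the sign of the
reflection itself. -/
noncomputable def signedConj (i : B) : Function.End (W × ZMod 2) := fun p =>
  (cs.simple i * p.1 * cs.simple i, p.2 + if p.1 = cs.simple i then 1 else 0)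

open Classical in
theorem signedConj_mul_pow (i j : B) (n : ℕ) (p : W × ZMod 2) :
    ((cs.signedConj i * cs.signedConj j) ^ n) p =
      ((cs.simple i * cs.simple j) ^ n * p.1 * ((cs.simple i * cs.simple j) ^ n)⁻¹,
        p.2 + ∑ k ∈ Finset.range (2 * n),
          if p.1 = cs.simple j * (cs.simple i * cs.simple j) ^ k then 1 else 0) := by
  induction n with
  | zero => simp; rfl
  | succ n ih =>
    rw [pow_succ']
    change (cs.signedConj i * cs.signedConj j) (((cs.signedConj i * cs.signedConj j) ^ n) p) = _
    rw [ih]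
    obtain ⟨t, e⟩ := p
    set x := cs.simple i * cs.simple j with hx
    have hji : cs.simple j * cs.simple i = x⁻¹ := by simp [hx]
    have hc : ∀ n : ℕ, cs.simple j * x ^ n * cs.simple j = (x ^ n)⁻¹ := by
      intro n
      induction n with
      | zero => simp
      | succ n ih =>
        calc _ = (cs.simple j * x ^ n * cs.simple j) * (cs.simple j * cs.simple i)
              * (cs.simple j * cs.simple j) := by
                rw [pow_succ, hx]; simp [mul_assoc]
          _ = _ := by rw [ih, hji]; simp [pow_succ']
    have hc' : ∀ n : ℕ, (x ^ n)⁻¹ * cs.simple j = cs.simple j * x ^ n := by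
      intro n
      rw [← hc]; simp [mul_assoc]
    have h1 : (x ^ n * t * (x ^ n)⁻¹ = cs.simple j) ↔ t = cs.simple j * x ^ (2 * n) := by
      rw [mul_inv_eq_iff_eq_mul, ← eq_inv_mul_iff_mul_eq, ← mul_assoc, hc', mul_assoc, ← pow_add,
        two_mul]
    have h2 : (cs.simple j * (x ^ n * t * (x ^ n)⁻¹) * cs.simple j = cs.simple i) ↔
        t = cs.simple j * x ^ (2 * n + 1) := by
      have : cs.simple i = x * cs.simple j := by simp [hx, mul_assoc]
      rw [this, mul_left_inj, ← eq_inv_mul_iff_mul_eq, cs.inv_simple, mul_inv_eq_iff_eq_mul,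
        ← eq_inv_mul_iff_mul_eq, ← mul_assoc, ← mul_assoc, hc', mul_assoc, mul_assoc, ← pow_succ',
        ← pow_add]
      ring_nf
    simp only [Function.End.mul_def, Function.comp, signedConj]
    rw [show 2 * (n + 1) = 2 * n + 1 + 1 by ring, Finset.sum_range_succ, Finset.sum_range_succ]
    simp only [h1, h2]
    refine Prod.ext ?_ ?_
    · simp only [pow_succ', hx, mul_inv_rev, cs.inv_simple]
      group
    · simp only; ring

theorem signedConj_liftable : M.IsLiftable cs.signedConj := by
  classical
  intro i j
  funext p
  -- The summand has period `M i j` in `k`, so the two halves of the range agree and cancel in `ZMod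
  -- 2`.
  rw [signedConj_mul_pow, cs.simple_mul_simple_pow, two_mul, Finset.sum_range_add]
  simp only [pow_add, cs.simple_mul_simple_pow, one_mul, CharTwo.add_self_eq_zero]
  simp only [inv_one, mul_one, add_zero]
  rfl

/-- The parity of the position of `t` with respect to `w`. -/
noncomputable def sign (w t : W) : ZMod 2 :=
  (cs.lift ⟨cs.signedConj, cs.signedConj_liftable⟩ w (t, 0)).2

theorem lift_signedConj_apply (w : W) (p : W × ZMod 2) :
    cs.lift ⟨cs.signedConj, cs.signedConj_liftable⟩ w p =
      (w * p.1 * w⁻¹, p.2 + cs.sign w p.1) := by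
  induction w using cs.simple_induction_left generalizing p with
  | one =>
    have h : ∀ p, cs.lift ⟨cs.signedConj, cs.signedConj_liftable⟩ 1 p = p := by
      intro p; rw [map_one]; rfl
    rw [h, sign, h]; simp
  | mul_simple_left w i ih =>
    have h : ∀ p, cs.lift ⟨cs.signedConj, cs.signedConj_liftable⟩ (cs.simple i * w) p =
        cs.signedConj i (cs.lift ⟨cs.signedConj, cs.signedConj_liftable⟩ w p) := by
      intro p
      rw [map_mul, cs.lift_apply_simple]; rfl
    have h2 : cs.sign (cs.simple i * w) p.1 =
        (cs.signedConj i (cs.lift ⟨cs.signedConj, cs.signedConj_liftable⟩ w (p.1, 0))).2 := by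
      rw [← h]; rfl
    rw [h, h2, ih, ih]
    simp only [signedConj]
    refine Prod.ext ?_ ?_
    · simp [mul_assoc]
    · simp [add_assoc]

theorem sign_mul (x y t : W) : cs.sign (x * y) t = cs.sign y t + cs.sign x (y * t * y⁻¹) := by
  have h : cs.lift ⟨cs.signedConj, cs.signedConj_liftable⟩ (x * y) (t, 0) =
      cs.lift ⟨cs.signedConj, cs.signedConj_liftable⟩ x
        (cs.lift ⟨cs.signedConj, cs.signedConj_liftable⟩ y (t, 0)) := by
    rw [map_mul]; rfl
  rw [sign, h, lift_signedConj_apply, lift_signedConj_apply]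
  simp

theorem sign_one (t : W) : cs.sign 1 t = 0 := by
  rw [sign, map_one]; rfl

open Classical in
theorem sign_simple (i : B) (t : W) : cs.sign (cs.simple i) t = if t = cs.simple i then 1 else 0 := by
  rw [sign, cs.lift_apply_simple]
  simp [signedConj]

/-- The contributions of `w` and `w⁻¹` cancel, since `w * w⁻¹` has sign zero; the middle letter
contributes one. -/
theorem sign_self {t : W} (ht : cs.IsReflection t) : cs.sign t t = 1 := by
  obtain ⟨w, i, rfl⟩ := ht
  have h1 : cs.sign (w * w⁻¹) (w * cs.simple i * w⁻¹) = 0 := by rw [mul_inv_cancel, sign_one]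
  rw [sign_mul] at h1
  rw [sign_mul, sign_mul]
  have h2 : w⁻¹ * (w * cs.simple i * w⁻¹) * w⁻¹⁻¹ = cs.simple i := by group
  rw [h2] at h1 ⊢
  rw [sign_simple, if_pos rfl, cs.inv_simple, cs.simple_mul_simple_self, one_mul, ← add_assoc,
    add_right_comm, h1, zero_add]

theorem mem_leftInvSeq_of_sign_ne_zero (ω : List B) (t : W)
    (h : cs.sign (cs.wordProd ω)⁻¹ t ≠ 0) : t ∈ cs.leftInvSeq ω := by
  induction ω generalizing t with
  | nil => simp [sign_one] at h
  | cons i ω ih =>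
    rw [cs.wordProd_cons, mul_inv_rev, cs.inv_simple, sign_mul, sign_simple, cs.inv_simple] at h
    rw [leftInvSeq, List.mem_cons]
    by_cases ht : t = cs.simple i
    · exact Or.inl ht
    · rw [if_neg ht, zero_add] at h
      exact Or.inr (List.mem_map.2 ⟨_, ih _ h, by simp [mul_assoc]⟩)

/-- A nonzero sign makes `t` occur in the inversion sequence of a reduced word. Conversely, passing
from `w` to `t * w` flips both the sign and the inversion status, so sign zero excludes an
inversion. -/
theorem isLeftInversion_iff_sign {w t : W} (ht : cs.IsReflection t) :
    cs.IsLeftInversion w t ↔ cs.sign w⁻¹ t = 1 := by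
  have key : ∀ w, cs.sign w⁻¹ t ≠ 0 → cs.IsLeftInversion w t := by
    intro w h
    obtain ⟨ω, hω, rfl⟩ := cs.exists_isReduced w
    exact cs.isLeftInversion_of_mem_leftInvSeq hω (cs.mem_leftInvSeq_of_sign_ne_zero ω t h)
  refine ⟨fun h => ?_, fun h => key w (by rw [h]; exact one_ne_zero)⟩
  by_contra hne
  have h0 : cs.sign w⁻¹ t = 0 := by
    generalize cs.sign w⁻¹ t = e at hne
    revert hne; revert e; decide
  have h1 : cs.sign (t * w)⁻¹ t = 1 := by
    rw [mul_inv_rev, ht.inv, sign_mul, cs.sign_self ht, ht.inv, ht.mul_self, one_mul, h0, add_zero]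
  exact ht.isLeftInversion_mul_right_iff.1 (key _ (by rw [h1]; exact one_ne_zero)) h

/-- The cocycle property of left inversions. -/
theorem isLeftInversion_mul_iff {x y t : W} (ht : cs.IsReflection t) :
    cs.IsLeftInversion (x * y) t ↔
      ¬ (cs.IsLeftInversion x t ↔ cs.IsLeftInversion y (x⁻¹ * t * x)) := by
  have ht' : cs.IsReflection (x⁻¹ * t * x) := by simpa using ht.conj x⁻¹
  rw [cs.isLeftInversion_iff_sign ht, cs.isLeftInversion_iff_sign ht,
    cs.isLeftInversion_iff_sign ht', mul_inv_rev, sign_mul, inv_inv]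
  generalize cs.sign x⁻¹ t = a
  generalize cs.sign y⁻¹ _ = b
  revert a b; decide

theorem isLeftInversion_simple_iff {i : B} {t : W} :
    cs.IsLeftInversion (cs.simple i) t ↔ t = cs.simple i := by
  constructor
  · rintro ⟨_, h⟩
    rw [cs.length_simple, Nat.lt_one_iff, cs.length_eq_zero_iff] at h
    rw [eq_inv_of_mul_eq_one_left h, cs.inv_simple]
  · rintro rfl
    exact ⟨cs.isReflection_simple i, by simp⟩

/-- The strong exchange condition. The word need not be reduced: sign one alone forces `t` to occur
in its inversion sequence. -/
theorem exists_eraseIdx_of_isLeftInversion {ω : List B} {t : W}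
    (h : cs.IsLeftInversion (cs.wordProd ω) t) :
    ∃ k < ω.length, t * cs.wordProd ω = cs.wordProd (ω.eraseIdx k) := by
  have h1 := (cs.isLeftInversion_iff_sign h.1).1 h
  have h2 := cs.mem_leftInvSeq_of_sign_ne_zero ω t (by rw [h1]; exact one_ne_zero)
  obtain ⟨k, hk, rfl⟩ := List.mem_iff_getElem.1 h2
  refine ⟨k, by simpa using hk, ?_⟩
  rw [← cs.getD_leftInvSeq_mul_wordProd, List.getD_eq_getElem _ _ hk]

theorem length_simple_mul_of_up {i : B} {x : W}
    (h : ¬ cs.IsLeftInversion x (cs.simple i)) : cs.length (cs.simple i * x) = cs.length x + 1 := by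
  rw [isLeftInversion_simple_iff_isLeftDescent] at h
  exact cs.not_isLeftDescent_iff.1 h

/-! ## Parabolic subgroups -/

/-- The parabolic subgroup generated by the simple reflections in `J`. -/
def parabolic (J : Set B) : Subgroup W := Subgroup.closure (cs.simple '' J)

variable {cs} {J : Set B}

theorem simple_mem_parabolic {i : B} (h : i ∈ J) : cs.simple i ∈ cs.parabolic J :=
  Subgroup.subset_closure ⟨i, h, rfl⟩

theorem exists_word_of_mem_parabolic {a : W} (ha : a ∈ cs.parabolic J) :
    ∃ ω : List B, (∀ i ∈ ω, i ∈ J) ∧ cs.wordProd ω = a := by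
  induction ha using Subgroup.closure_induction with
  | mem x hx => obtain ⟨i, hi, rfl⟩ := hx; exact ⟨[i], by simpa using hi, by simp⟩
  | one => exact ⟨[], by simp, by simp⟩
  | mul x y _ _ hx hy =>
    obtain ⟨ω, h1, rfl⟩ := hx
    obtain ⟨ω', h2, rfl⟩ := hy
    exact ⟨ω ++ ω', by simpa [or_imp, forall_and] using ⟨h1, h2⟩, cs.wordProd_append _ _⟩
  | inv x _ hx =>
    obtain ⟨ω, h1, rfl⟩ := hx
    exact ⟨ω.reverse, by simpa using h1, cs.wordProd_reverse _⟩

theorem mem_parabolic_of_isLeftInversion {a t : W} (ha : a ∈ cs.parabolic J)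
    (h : cs.IsLeftInversion a t) : t ∈ cs.parabolic J := by
  obtain ⟨ω, hω, rfl⟩ := exists_word_of_mem_parabolic ha
  clear ha
  induction ω generalizing t with
  | nil => simp [IsLeftInversion] at h
  | cons i ω ih =>
    rw [cs.wordProd_cons, cs.isLeftInversion_mul_iff h.1, isLeftInversion_simple_iff] at h
    have hi : cs.simple i ∈ cs.parabolic J := simple_mem_parabolic (hω i (by simp))
    by_cases ht : t = cs.simple i
    · rwa [ht]
    · have h' : cs.IsLeftInversion (cs.wordProd ω) ((cs.simple i)⁻¹ * t * cs.simple i) := by tauto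
      have := ih (fun k hk => hω k (by simp [hk])) h'
      have h2 := mul_mem (mul_mem hi this) hi
      simpa [mul_assoc] using h2

/-- Take a word with letters in `J` that is shortest among such words, not necessarily reduced in
`W`. If its first letter were not a descent, exchange would delete a letter of the tail and give a
shorter one. -/
theorem exists_descent_of_mem_parabolic {a : W} (ha : a ∈ cs.parabolic J) (h1 : a ≠ 1) :
    ∃ i ∈ J, cs.IsLeftInversion a (cs.simple i) := by
  classical
  have hex : ∃ n, ∃ ω : List B, ω.length = n ∧ (∀ i ∈ ω, i ∈ J) ∧ cs.wordProd ω = a := by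
    obtain ⟨ω, h⟩ := exists_word_of_mem_parabolic ha
    exact ⟨_, ω, rfl, h⟩
  obtain ⟨ω, hlen, hω, rfl⟩ := Nat.find_spec hex
  cases ω with
  | nil => simp at h1
  | cons i ω =>
    refine ⟨i, hω i (by simp), ?_⟩
    by_contra hn
    rw [cs.wordProd_cons, (cs.isReflection_simple i).isLeftInversion_mul_right_iff, not_not] at hn
    obtain ⟨k, hk, he⟩ := cs.exists_eraseIdx_of_isLeftInversion hn
    refine Nat.find_min hex (m := (ω.eraseIdx k).length) ?_
      ⟨_, rfl, fun l hl => hω l ?_, ?_⟩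
    · rw [← hlen]
      have := List.length_eraseIdx_le ω k
      simp; omega
    · exact List.mem_cons_of_mem _ (List.mem_of_mem_eraseIdx hl)
    · rw [cs.wordProd_cons, he]

/-- An element without left descents in `J` has no left inversions in `W_J`. -/
theorem not_isLeftInversion_of_no_descent {d : W}
    (hd : ∀ i ∈ J, ¬ cs.IsLeftInversion d (cs.simple i)) {t : W} (ht : t ∈ cs.parabolic J) :
    ¬ cs.IsLeftInversion d t := by
  classical
  have hex : ∃ n, ∃ a ∈ cs.parabolic J, cs.length (a * d) = n := ⟨_, 1, one_mem _, rfl⟩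
  -- `a * d` has least length in the coset `W_J d`, so it has no inversion in `W_J`. If `a ≠ 1`, a
  -- descent of `a⁻¹` would then be a descent of `d = a⁻¹ * (a * d)`.
  obtain ⟨a, ha, hlen⟩ := Nat.find_spec hex
  have hmin : ∀ b ∈ cs.parabolic J, ¬ cs.IsLeftInversion (a * d) b := by
    intro b hb h
    refine Nat.find_min hex (m := cs.length (b * (a * d))) ?_ ⟨b * a, mul_mem hb ha, by rw [mul_assoc]⟩
    rw [← hlen]; exact h.2
  have : a⁻¹ = 1 := by
    by_contra hne
    obtain ⟨i, hi, hinv⟩ := exists_descent_of_mem_parabolic (inv_mem ha) hne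
    apply hd i hi
    have : d = a⁻¹ * (a * d) := by group
    rw [this, cs.isLeftInversion_mul_iff (cs.isReflection_simple i)]
    have := hmin (a⁻¹⁻¹ * cs.simple i * a⁻¹)
      (mul_mem (mul_mem (inv_mem (inv_mem ha)) (simple_mem_parabolic hi)) (inv_mem ha))
    tauto
  rw [inv_eq_one] at this
  rw [this, one_mul] at hmin
  exact hmin t ht

theorem isLeftInversion_mul_of_no_descent {d : W}
    (hd : ∀ i ∈ J, ¬ cs.IsLeftInversion d (cs.simple i)) {a t : W} (ha : a ∈ cs.parabolic J)
    (htr : cs.IsReflection t) (ht : t ∈ cs.parabolic J) :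
    cs.IsLeftInversion (a * d) t ↔ cs.IsLeftInversion a t := by
  rw [cs.isLeftInversion_mul_iff htr]
  have := not_isLeftInversion_of_no_descent hd (mul_mem (mul_mem (inv_mem ha) ht) ha)
  tauto

theorem length_mul_of_no_descent {d : W}
    (hd : ∀ i ∈ J, ¬ cs.IsLeftInversion d (cs.simple i)) {a : W} (ha : a ∈ cs.parabolic J) :
    cs.length (a * d) = cs.length a + cs.length d := by
  induction hn : cs.length a generalizing a with
  | zero => rw [cs.length_eq_zero_iff] at hn; simp [hn]
  | succ n ih =>
    have h1 : a ≠ 1 := by rintro rfl; simp at hn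
    obtain ⟨i, hi, hinv⟩ := exists_descent_of_mem_parabolic ha h1
    have hinv' := (isLeftInversion_mul_of_no_descent hd ha (cs.isReflection_simple i)
      (simple_mem_parabolic hi)).2 hinv
    rw [isLeftInversion_simple_iff_isLeftDescent, isLeftDescent_iff] at hinv hinv'
    have := ih (mul_mem (simple_mem_parabolic hi) ha) (by omega)
    rw [mul_assoc] at this
    omega

end CoxeterSystem

/-! ## Alternating products -/

/-- The letter with index `k` of the sequence `x, y, x, y, …`. -/
def altLetter {α : Type*} (x y : α) (k : ℕ) : α := if Even k then x else y

section altLetter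

variable {α : Type*} (x y : α)

@[simp] theorem altLetter_zero : altLetter x y 0 = x := rfl

theorem altLetter_succ (k : ℕ) : altLetter x y (k + 1) = altLetter y x k := by
  unfold altLetter; by_cases h : Even k <;> simp [h, Nat.even_add_one]

theorem altLetter_two_mul (k : ℕ) : altLetter x y (2 * k) = x := by simp [altLetter]

theorem altLetter_cases (k : ℕ) :
    (altLetter x y k = x ∧ altLetter y x k = y) ∨ (altLetter x y k = y ∧ altLetter y x k = x) := by
  unfold altLetter; by_cases h : Even k <;> simp [h]

theorem apply_altLetter {β : Type*} (f : α → β) (k : ℕ) :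
    f (altLetter x y k) = altLetter (f x) (f y) k := by
  unfold altLetter; split_ifs <;> rfl

end altLetter

/-- The alternating product of `k` factors ending in `x`. -/
def altMul {G : Type*} [Monoid G] (x y : G) : ℕ → G
  | 0 => 1
  | k + 1 => altLetter x y k * altMul x y k

theorem mul_mul_pow_eq {G : Type*} [Monoid G] (x y : G) (k : ℕ) : x * (y * x) ^ k = (x * y) ^ k * x := by
  induction k with
  | zero => simp
  | succ k ih => rw [pow_succ, ← mul_assoc, ih, pow_succ]; simp only [mul_assoc]

section altMul

variable {G : Type*} [Monoid G]

@[simp] theorem altMul_zero (x y : G) : altMul x y 0 = 1 := rfl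

theorem altMul_succ (x y : G) (k : ℕ) : altMul x y (k + 1) = altLetter x y k * altMul x y k := rfl

theorem altMul_succ' (x y : G) (k : ℕ) : altMul x y (k + 1) = altMul y x k * x := by
  induction k with
  | zero => simp [altMul]
  | succ k ih => rw [altMul_succ, ih, ← mul_assoc, altLetter_succ, ← altMul_succ]

@[simp] theorem altMul_one (x y : G) : altMul x y 1 = x := by simp [altMul]

end altMul

theorem altMul_mem {G : Type*} [Group G] {H : Subgroup G} {x y : G} (hx : x ∈ H) (hy : y ∈ H) (k : ℕ) :
    altMul x y k ∈ H := by
  induction k with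
  | zero => exact one_mem _
  | succ k ih =>
    rw [altMul_succ]
    refine mul_mem ?_ ih
    rcases altLetter_cases x y k with h | h <;> rw [h.1] <;> assumption

theorem altMul_inv_mul_altMul {G : Type*} [Group G] {x y : G} (hx : x * x = 1) (hy : y * y = 1)
    (k : ℕ) : (altMul y x k)⁻¹ * altMul x y k = (y * x) ^ k := by
  induction k generalizing x y with
  | zero => simp
  | succ k ih =>
    rw [altMul_succ', altMul_succ', mul_inv_rev, mul_assoc, ← mul_assoc _ (altMul y x k), ih hy hx,
      inv_eq_of_mul_eq_one_left hy, ← mul_assoc, mul_mul_pow_eq, pow_succ, mul_assoc]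

/-! ### Dihedral subgroups and lengths of alternating products. -/

namespace CoxeterSystem

variable {B : Type u} {W : Type v} [Group W] {M : CoxeterMatrix B} {cs : CoxeterSystem M W}

variable (cs) in
theorem orderOf_simple_mul_comm (i j : B) :
    orderOf (cs.simple j * cs.simple i) = orderOf (cs.simple i * cs.simple j) := by
  rw [← orderOf_inv (cs.simple i * cs.simple j)]; simp

variable (cs) in
-- The order of `s_i s_j` replaces the matrix entry `M i j`, so the two never have to be compared.
-- Order zero means infinite order, order one means that `i` and `j` name the same reflection.
theorem altMul_orderOf (i j : B) :
    altMul (cs.simple i) (cs.simple j) (orderOf (cs.simple i * cs.simple j)) =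
      altMul (cs.simple j) (cs.simple i) (orderOf (cs.simple i * cs.simple j)) := by
  have := altMul_inv_mul_altMul (cs.simple_mul_simple_self i) (cs.simple_mul_simple_self j)
    (orderOf (cs.simple i * cs.simple j))
  rw [← orderOf_simple_mul_comm, pow_orderOf_eq_one, inv_mul_eq_one] at this
  rw [← orderOf_simple_mul_comm]
  exact this.symm

theorem isLeftInversion_altMul {i j : B} {k : ℕ} {t : W}
    (h : cs.IsLeftInversion (altMul (cs.simple i) (cs.simple j) k) t) :
    ∃ l < k, t = (altLetter (cs.simple j) (cs.simple i) k * altLetter (cs.simple i) (cs.simple j) k) ^ l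
      * altLetter (cs.simple j) (cs.simple i) k := by
  induction k generalizing t with
  | zero => simp [IsLeftInversion] at h
  | succ k ih =>
    rw [altLetter_succ, altLetter_succ]
    have hc : ∃ c, altLetter (cs.simple i) (cs.simple j) k = cs.simple c := by
      rcases altLetter_cases (cs.simple i) (cs.simple j) k with h | h
      exacts [⟨_, h.1⟩, ⟨_, h.1⟩]
    rw [altMul_succ] at h
    obtain ⟨c, hc⟩ := hc
    rw [hc] at ih h ⊢
    rw [cs.isLeftInversion_mul_iff h.1, isLeftInversion_simple_iff] at h
    by_cases ht : t = cs.simple c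
    · exact ⟨0, by omega, by simpa using ht⟩
    · have h' : cs.IsLeftInversion (altMul (cs.simple i) (cs.simple j) k)
          ((cs.simple c)⁻¹ * t * cs.simple c) := by tauto
      obtain ⟨l, hl, hl'⟩ := ih h'
      refine ⟨l + 1, by omega, ?_⟩
      rw [← mul_mul_pow_eq, pow_succ, ← mul_assoc _ _ (cs.simple c), ← hl']
      simp [mul_assoc]

/-- Let `c` be the next letter and `c'` the other one. If `c` were an inversion, then `c = (c' c)^l
c'` with `l < k`, so `(c' c)^(l + 1) = 1` with an exponent below the order. -/
theorem not_isLeftInversion_altMul {i j : B} {k : ℕ}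
    (hk : orderOf (cs.simple i * cs.simple j) = 0 ∨ k < orderOf (cs.simple i * cs.simple j)) :
    ¬ cs.IsLeftInversion (altMul (cs.simple i) (cs.simple j) k)
      (altLetter (cs.simple i) (cs.simple j) k) := by
  intro h
  obtain ⟨l, hl, h⟩ := isLeftInversion_altMul h
  have hd : orderOf (cs.simple i * cs.simple j) ∣ l + 1 := by
    rcases altLetter_cases (cs.simple i) (cs.simple j) k with hc | hc <;> rw [hc.1, hc.2] at h
    · rw [← orderOf_simple_mul_comm, orderOf_dvd_iff_pow_eq_one, pow_succ, ← mul_assoc, ← h,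
        cs.simple_mul_simple_self]
    · rw [orderOf_dvd_iff_pow_eq_one, pow_succ, ← mul_assoc, ← h, cs.simple_mul_simple_self]
  rcases hk with hk | hk
  · rw [hk] at hd; simp at hd
  · have := Nat.le_of_dvd (by omega) hd; omega

theorem length_altMul {i j : B} {k : ℕ}
    (hk : orderOf (cs.simple i * cs.simple j) = 0 ∨ k ≤ orderOf (cs.simple i * cs.simple j)) :
    cs.length (altMul (cs.simple i) (cs.simple j) k) = k := by
  induction k with
  | zero => simp
  | succ k ih =>
    have h := not_isLeftInversion_altMul (cs := cs) (i := i) (j := j) (k := k) (by omega)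
    rw [altMul_succ]
    rw [← apply_altLetter _ _ cs.simple] at h ⊢
    rw [cs.length_simple_mul_of_up h, ih (by omega)]

/-- An element with left descents `i` and `j` is divisible by the alternating products. -/
theorem exists_eq_altMul_mul {i j : B} {x : W} (hi : cs.IsLeftInversion x (cs.simple i))
    (hj : cs.IsLeftInversion x (cs.simple j)) {k : ℕ}
    (hk : orderOf (cs.simple i * cs.simple j) = 0 ∨ k ≤ orderOf (cs.simple i * cs.simple j)) :
    ∃ y, x = altMul (cs.simple i) (cs.simple j) k * y ∧ cs.length x = k + cs.length y := by
  induction k with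
  | zero => exact ⟨x, by simp⟩
  | succ k ih =>
    obtain ⟨y, hxy, hl⟩ := ih (by omega)
    set p := altMul (cs.simple i) (cs.simple j) k with hp
    set r := altLetter (cs.simple i) (cs.simple j) k with hr
    have hn : ¬ cs.IsLeftInversion p r := not_isLeftInversion_altMul (by omega)
    have hx : cs.IsLeftInversion x r := by
      rw [hr]; rcases altLetter_cases (cs.simple i) (cs.simple j) k with h | h <;> rw [h.1] <;> assumption
    have hrr := hx.1
    rw [hxy, cs.isLeftInversion_mul_iff hrr] at hx
    -- `r` is an inversion of `p * y` but not of `p`, so the cocycle moves it to `y`. Removing it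
    -- from `y` extends `p` by `r`.
    have hy : cs.IsLeftInversion y (p⁻¹ * r * p) := by tauto
    have he : x = altMul (cs.simple i) (cs.simple j) (k + 1) * (p⁻¹ * r * p * y) := by
      rw [altMul_succ, ← hr, ← hp, hxy]
      simp only [mul_assoc, mul_inv_cancel_left]
      rw [← mul_assoc r r, hrr.mul_self, one_mul]
    refine ⟨_, he, ?_⟩
    have h1 := cs.length_mul_le (altMul (cs.simple i) (cs.simple j) (k + 1)) (p⁻¹ * r * p * y)
    rw [← he, length_altMul hk] at h1
    have h2 := hy.2
    omega

/-- Infinite order would split off from `x` an alternating factor longer than `x`. -/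
theorem orderOf_pos_of_descents {i j : B} {x : W} (hi : cs.IsLeftInversion x (cs.simple i))
    (hj : cs.IsLeftInversion x (cs.simple j)) : 0 < orderOf (cs.simple i * cs.simple j) := by
  by_contra h
  obtain ⟨y, -, hy⟩ := exists_eq_altMul_mul hi hj (k := cs.length x + 1) (by omega)
  omega

/-! ## Matsumoto's theorem -/

/-- The alternating word with `k` letters ending in `i`. -/
def altList {α : Type*} (i j : α) : ℕ → List α
  | 0 => []
  | k + 1 => altLetter i j k :: altList i j k

theorem prod_map_altList {α G : Type*} [Monoid G] (f : α → G) (i j : α) (k : ℕ) :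
    ((altList i j k).map f).prod = altMul (f i) (f j) k := by
  induction k with
  | zero => rfl
  | succ k ih => rw [altList, List.map_cons, List.prod_cons, ih, altMul_succ, apply_altLetter _ _ f]

theorem length_altList {α : Type*} (i j : α) (k : ℕ) : (altList i j k).length = k := by
  induction k with
  | zero => rfl
  | succ k ih => rw [altList, List.length_cons, ih]

theorem wordProd_altList (i j : B) (k : ℕ) :
    cs.wordProd (altList i j k) = altMul (cs.simple i) (cs.simple j) k :=
  prod_map_altList cs.simple i j k

theorem IsReduced.tail {i : B} {ω : List B} (h : cs.IsReduced (i :: ω)) : cs.IsReduced ω := by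
  simpa using h.drop 1

theorem IsReduced.isLeftInversion_head {i : B} {ω : List B} (h : cs.IsReduced (i :: ω)) :
    cs.IsLeftInversion (cs.wordProd (i :: ω)) (cs.simple i) := by
  refine ⟨cs.isReflection_simple i, ?_⟩
  rw [h.eq, cs.wordProd_cons, cs.simple_mul_simple_cancel_left, h.tail.eq]
  simp

/-- Matsumoto's theorem. -/
theorem prod_map_eq_of_isReduced {G : Type*} [Monoid G] (f : B → G)
    (hf : ∀ i j, 0 < orderOf (cs.simple i * cs.simple j) →
      altMul (f i) (f j) (orderOf (cs.simple i * cs.simple j)) =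
        altMul (f j) (f i) (orderOf (cs.simple i * cs.simple j)))
    {ω ω' : List B} (hω : cs.IsReduced ω) (hω' : cs.IsReduced ω')
    (h : cs.wordProd ω = cs.wordProd ω') : (ω.map f).prod = (ω'.map f).prod := by
  induction hn : ω.length generalizing ω ω' with
  | zero =>
    have h1 : ω'.length = 0 := by rw [← hω'.eq, ← h, hω.eq, hn]
    rw [List.length_eq_zero_iff.1 hn, List.length_eq_zero_iff.1 h1]
  | succ n ih =>
    have hn' : ω'.length = n + 1 := by rw [← hω'.eq, ← h, hω.eq, hn]
    match ω, ω', hn, hn' with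
    | i :: ω, j :: ω', hn, hn' =>
    have hi := hω.isLeftInversion_head
    have hj := hω'.isLeftInversion_head
    rw [← h] at hj
    set m := orderOf (cs.simple i * cs.simple j) with hm
    have hpos : 0 < m := orderOf_pos_of_descents hi hj
    -- Both alternating words of length `m` are prefixes of the same element. Each given word shares
    -- its first letter with one of them, so the induction applies to tails, and `hf` exchanges the
    -- two prefixes.
    obtain ⟨y, hy, hly⟩ := exists_eq_altMul_mul hi hj (k := m) (Or.inr le_rfl)
    obtain ⟨η, hη, rfl⟩ := cs.exists_isReduced y
    -- a reduced word starting with `c` has the same image as an alternating word followed by `η`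
    have step : ∀ (a b c : B) (τ : List B), cs.IsReduced (c :: τ) → (c :: τ).length = n + 1 →
        cs.wordProd (c :: τ) = altMul (cs.simple a) (cs.simple b) m * cs.wordProd η →
        cs.length (cs.wordProd (c :: τ)) = m + cs.length (cs.wordProd η) →
        altLetter a b (m - 1) = c →
        ((c :: τ).map f).prod = altMul (f a) (f b) m * (η.map f).prod := by
      intro a b c τ hτ hlen hprod hl hc
      obtain ⟨p, hp⟩ : ∃ p, m = p + 1 := ⟨m - 1, by omega⟩
      rw [hp, Nat.add_sub_cancel] at hc
      rw [hp] at hprod hl ⊢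
      rw [altMul_succ, ← apply_altLetter _ _ cs.simple, hc] at hprod
      rw [altMul_succ, ← apply_altLetter _ _ f, hc]
      rw [cs.wordProd_cons, mul_assoc, mul_right_inj] at hprod
      rw [List.map_cons, List.prod_cons, mul_assoc]
      congr 1
      rw [← prod_map_altList, ← List.prod_append, ← List.map_append]
      have hp' : cs.wordProd τ = cs.wordProd (altList a b p ++ η) := by
        rw [hprod, cs.wordProd_append, wordProd_altList]
      refine ih hτ.tail ?_ hp' (by simpa using hlen)
      rw [IsReduced, ← hp', hτ.tail.eq, List.length_append, length_altList, ← hη.eq]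
      rw [hτ.eq, List.length_cons] at hl
      omega
    have e1 : cs.wordProd (i :: ω) = altMul (cs.simple j) (cs.simple i) m * cs.wordProd η := by
      rw [hy, altMul_orderOf]
    rcases altLetter_cases i j (m - 1) with hc | hc
    · rw [step i j i ω hω hn hy hly hc.1,
        step j i j ω' hω' hn' (by rw [← h, e1]) (by rw [← h, hly]) hc.2, hf i j hpos]
    · rw [step j i i ω hω hn e1 hly hc.2,
        step i j j ω' hω' hn' (by rw [← h, hy]) (by rw [← h, hly]) hc.1, hf i j hpos]

end CoxeterSystem

/-! ## Alternating products of Hecke operators -/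

section HeckeOperators

variable {R V : Type*} [CommRing R] [AddCommGroup V] [Module R V]

/-- The kernel of the difference of two alternating products is stable. -/
theorem altMul_sub_apply_eq_zero {A C : Module.End R V} {q : R}
    (hA : A * A = (q - 1) • A + q • 1) (hC : C * C = (q - 1) • C + q • 1) (m : ℕ) {v : V}
    (hv : altMul A C m v = altMul C A m v) :
    altMul A C m (C v) = altMul C A m (C v) := by
  cases m with
  | zero => simp
  | succ m =>
    set c := altLetter A C m with hc
    have hcc : c * c = (q - 1) • c + q • 1 := by
      rcases altLetter_cases A C m with h | h <;> rw [hc, h.1] <;> assumption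
    -- With `Δ` the difference of the two products, the three identities together say `Δ C = ((q -
    -- 1) - c) Δ`.
    have e1 : altMul A C (m + 1) * C = c * altMul C A (m + 1) := by
      rw [← altMul_succ', altMul_succ, altLetter_succ]
    have e2 : altMul C A (m + 1) * C = (q - 1) • altMul C A (m + 1) + q • altMul A C m := by
      rw [altMul_succ', mul_assoc, hC, mul_add, mul_smul_comm, mul_smul_comm, mul_one]
    have e3 : c * altMul A C (m + 1) = (q - 1) • altMul A C (m + 1) + q • altMul A C m := by
      rw [altMul_succ, ← mul_assoc, hcc, add_mul, smul_mul_assoc, smul_mul_assoc, one_mul]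
    have f1 := LinearMap.congr_fun e1 v
    have f2 := LinearMap.congr_fun e2 v
    have f3 := LinearMap.congr_fun e3 v
    simp only [Module.End.mul_apply, LinearMap.add_apply, LinearMap.smul_apply] at f1 f2 f3
    rw [f1, f2, ← hv, f3]

/-- The three-term recursion for the differences of alternating products. -/
theorem add_apply_altMul_sub {A C : Module.End R V} {q : R}
    (hA : A * A = (q - 1) • A + q • 1) (hC : C * C = (q - 1) • C + q • 1) (k : ℕ) (v : V) :
    (A + C - (q - 1) • 1) (altMul A C (k + 1) v - altMul C A (k + 1) v) =
      (altMul A C (k + 2) v - altMul C A (k + 2) v) + q • (altMul A C k v - altMul C A k v) := by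
  have h : ∀ A C : Module.End R V, A * A = (q - 1) • A + q • 1 → C * C = (q - 1) • C + q • 1 →
      (A + C) * altMul A C (k + 1) =
        altMul A C (k + 2) + (q - 1) • altMul A C (k + 1) + q • altMul A C k := by
    intro A C hA hC
    have hcc : altLetter A C k * altLetter A C k = (q - 1) • altLetter A C k + q • 1 := by
      rcases altLetter_cases A C k with h | h <;> rw [h.1] <;> assumption
    have hsum : A + C = altLetter A C (k + 1) + altLetter A C k := by
      rw [altLetter_succ]
      rcases altLetter_cases A C k with h | h <;> rw [h.1, h.2]
      rw [add_comm]
    have e3 : altLetter A C k * altMul A C (k + 1) =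
        (q - 1) • altMul A C (k + 1) + q • altMul A C k := by
      rw [altMul_succ, ← mul_assoc, hcc, add_mul, smul_mul_assoc, smul_mul_assoc, one_mul]
    rw [hsum, add_mul, e3, ← altMul_succ, ← add_assoc]
  have f1 := LinearMap.congr_fun (h A C hA hC) v
  have f2 := LinearMap.congr_fun (h C A hC hA) v
  rw [add_comm C A] at f2
  simp only [Module.End.mul_apply, LinearMap.add_apply, LinearMap.smul_apply] at f1 f2
  simp only [LinearMap.sub_apply, LinearMap.add_apply, LinearMap.smul_apply, Module.End.one_apply,
    map_sub]
  rw [f1, f2]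
  module

/-- The recursion is symmetric up to powers of `q`: the hypotheses propagate to `D (a + t) = c q^t D
(b + 1 - t)`, and `t = b + 1` meets `D 0 = 0`. No division by `q` occurs. -/
theorem eq_zero_of_reflection {L : Module.End R V} {q : R} {D : ℕ → V} (h0 : D 0 = 0)
    (h : ∀ k, L (D (k + 1)) = D (k + 2) + q • D k) {a b : ℕ} {c : R}
    (h1 : D a = c • D (b + 1)) (h2 : D (a + 1) = (c * q) • D b) : D (a + b + 1) = 0 := by
  induction b generalizing a c with
  | zero => rw [add_zero, h2, h0, smul_zero]
  | succ b ih =>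
    have := ih (a := a + 1) (c := c * q) h2 ?_
    · rw [← this]; congr 1; ring
    · have e1 := h a
      rw [h2, map_smul, h b, h1] at e1
      rw [show a + 1 + 1 = a + 2 from rfl, eq_sub_of_add_eq e1.symm]
      module

end HeckeOperators

namespace CoxeterSystem

variable {B : Type u} {W : Type v} [Group W] {M : CoxeterMatrix B} {cs : CoxeterSystem M W}

/-- The second product begins with `altLetter i j k`, which is not a descent of the first. -/
theorem altMul_ne {i j : B} {k : ℕ} (h0 : 0 < k)
    (hk : k < orderOf (cs.simple i * cs.simple j)) :
    altMul (cs.simple i) (cs.simple j) k ≠ altMul (cs.simple j) (cs.simple i) k := by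
  intro h
  have h1 := not_isLeftInversion_altMul (cs := cs) (i := i) (j := j) (k := k) (Or.inr hk)
  apply h1
  have e2 := length_altMul (cs := cs) (i := j) (j := i) (k := k)
    (Or.inr (by rw [orderOf_simple_mul_comm]; omega))
  obtain ⟨n, rfl⟩ : ∃ n, k = n + 1 := ⟨k - 1, by omega⟩
  have e1 := length_altMul (cs := cs) (i := j) (j := i) (k := n)
    (Or.inr (by rw [orderOf_simple_mul_comm]; omega))
  rw [h]
  rw [altMul_succ, altLetter_succ, ← apply_altLetter _ _ cs.simple] at *
  refine ⟨cs.isReflection_simple _, ?_⟩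
  rw [e2, cs.simple_mul_simple_cancel_left, e1]
  omega

end CoxeterSystem

namespace CoxeterInvolution

open CoxeterSystem

variable {B : Type u} {W : Type v} [Group W] {M : CoxeterMatrix B} {cs : CoxeterSystem M W}
  (θ : CoxeterInvolution cs)

/-! ## The automorphism and the length function -/

theorem exists_star_simple (i : B) : ∃ j, θ.toMulEquiv (cs.simple i) = cs.simple j := by
  have : θ.toMulEquiv (cs.simple i) ∈ Set.range cs.simple := by
    rw [← θ.image_simple]; exact ⟨_, ⟨i, rfl⟩, rfl⟩
  obtain ⟨j, hj⟩ := this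
  exact ⟨j, hj.symm⟩

theorem length_star (x : W) : cs.length (θ.toMulEquiv x) = cs.length x := by
  have h : ∀ x, cs.length (θ.toMulEquiv x) ≤ cs.length x := by
    intro x
    induction hn : cs.length x generalizing x with
    | zero => rw [cs.length_eq_zero_iff] at hn; simp [hn]
    | succ n ih =>
      have hx1 : x ≠ 1 := by rintro rfl; simp at hn
      obtain ⟨i, hi⟩ := cs.exists_leftDescent_of_ne_one hx1
      rw [cs.isLeftDescent_iff] at hi
      obtain ⟨j, hj⟩ := θ.exists_star_simple i
      have h1 : θ.toMulEquiv x = cs.simple j * θ.toMulEquiv (cs.simple i * x) := by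
        rw [map_mul, hj, cs.simple_mul_simple_cancel_left]
      have h2 := cs.length_mul_le (cs.simple j) (θ.toMulEquiv (cs.simple i * x))
      have h3 := ih (cs.simple i * x) (by omega)
      rw [h1]
      rw [cs.length_simple] at h2
      omega
  refine le_antisymm (h x) ?_
  have := h (θ.toMulEquiv x)
  rwa [θ.star_star] at this

theorem isReflection_star {t : W} (ht : cs.IsReflection t) : cs.IsReflection (θ.toMulEquiv t) := by
  obtain ⟨w, i, rfl⟩ := ht
  obtain ⟨j, hj⟩ := θ.exists_star_simple i
  exact ⟨θ.toMulEquiv w, j, by rw [map_mul, map_mul, map_inv, hj]⟩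

theorem isLeftInversion_star {x t : W} (h : cs.IsLeftInversion (θ.toMulEquiv x) t) :
    cs.IsLeftInversion x (θ.toMulEquiv t) := by
  refine ⟨θ.isReflection_star h.1, ?_⟩
  have := h.2
  rwa [← θ.length_star, map_mul, θ.star_star, θ.length_star] at this

/-- Since `z^* = z⁻¹`, the inverse of `z c^*` is the image of `c⁻¹ z` under the automorphism. This
turns right multiplications into left ones. -/
theorem length_mul_star (z : θ.TwistedInv) (c : W) :
    cs.length (z.1 * θ.toMulEquiv c) = cs.length (c⁻¹ * z.1) := by
  rw [← cs.length_inv, mul_inv_rev, ← z.2, ← map_inv, ← map_mul, θ.length_star]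

theorem star_simple_mul_self (i : B) :
    θ.toMulEquiv (cs.simple i) * θ.toMulEquiv (cs.simple i) = 1 := by
  rw [← map_mul, cs.simple_mul_simple_self, map_one]

/-! ## The operation `⋉` -/

variable {θ}

theorem ltimes_of_comm {i : B} {z : θ.TwistedInv} (h : θ.Comm i z.1) :
    (θ.ltimes i z).1 = cs.simple i * z.1 := by
  rw [ltimes, dif_pos h]

theorem ltimes_of_not_comm {i : B} {z : θ.TwistedInv} (h : ¬ θ.Comm i z.1) :
    (θ.ltimes i z).1 = cs.simple i * z.1 * θ.toMulEquiv (cs.simple i) := by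
  rw [ltimes, dif_neg h]

theorem comm_ltimes_iff {i : B} {z : θ.TwistedInv} :
    θ.Comm i (θ.ltimes i z).1 ↔ θ.Comm i z.1 := by
  by_cases h : θ.Comm i z.1
  · rw [ltimes_of_comm h]
    refine iff_of_true ?_ h
    unfold Comm at *
    rw [h, mul_assoc, θ.star_simple_mul_self, ← h, cs.simple_mul_simple_cancel_left, mul_one]
  · rw [ltimes_of_not_comm h]
    refine iff_of_false ?_ h
    intro h'
    apply h
    unfold Comm at *
    rw [mul_assoc, mul_assoc, mul_assoc, θ.star_simple_mul_self,
      cs.simple_mul_simple_cancel_left, mul_one] at h'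
    exact h'.symm

theorem ltimes_ltimes (i : B) (z : θ.TwistedInv) : θ.ltimes i (θ.ltimes i z) = z := by
  apply Subtype.ext
  by_cases h : θ.Comm i z.1
  · rw [ltimes_of_comm (comm_ltimes_iff.2 h), ltimes_of_comm h, cs.simple_mul_simple_cancel_left]
  · rw [ltimes_of_not_comm (comm_ltimes_iff.not.2 h), ltimes_of_not_comm h, mul_assoc, mul_assoc,
      mul_assoc, θ.star_simple_mul_self, mul_one, cs.simple_mul_simple_cancel_left]

theorem ltimes_congr {i j : B} (h : cs.simple i = cs.simple j) (z : θ.TwistedInv) :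
    θ.ltimes i z = θ.ltimes j z := by
  apply Subtype.ext
  by_cases hc : θ.Comm i z.1
  · have hc' : θ.Comm j z.1 := by unfold Comm at *; rwa [← h]
    rw [ltimes_of_comm hc, ltimes_of_comm hc', h]
  · have hc' : ¬ θ.Comm j z.1 := by unfold Comm at *; rwa [← h]
    rw [ltimes_of_not_comm hc, ltimes_of_not_comm hc', h]

variable (θ) in
/-- `s z > z`. -/
def Up (i : B) (z : θ.TwistedInv) : Prop := ¬ cs.IsLeftInversion z.1 (cs.simple i)

theorem up_iff {i : B} {z : θ.TwistedInv} :
    θ.Up i z ↔ cs.length z.1 < cs.length (cs.simple i * z.1) := by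
  rw [Up, isLeftInversion_simple_iff_isLeftDescent, IsLeftDescent, not_lt]
  have := cs.length_simple_mul_ne z.1 i
  omega

theorem not_up_iff {i : B} {z : θ.TwistedInv} :
    ¬ θ.Up i z ↔ cs.length (cs.simple i * z.1) < cs.length z.1 := by
  rw [up_iff, not_lt]
  have := cs.length_simple_mul_ne z.1 i
  omega

theorem Up.length_eq {i : B} {z : θ.TwistedInv} (h : θ.Up i z) :
    cs.length (cs.simple i * z.1) = cs.length z.1 + 1 := cs.length_simple_mul_of_up h

/-- The inversions of `z s^*` differ from those of `z` only at `z s^* z⁻¹`, which equals `s` exactly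
in the commuting case. So the left multiplication raises the length again. -/
theorem Up.length_of_not_comm {i : B} {z : θ.TwistedInv} (h : θ.Up i z) (hc : ¬ θ.Comm i z.1) :
    cs.length (θ.ltimes i z).1 = cs.length z.1 + 2 := by
  rw [ltimes_of_not_comm hc, mul_assoc]
  have h1 : cs.length (z.1 * θ.toMulEquiv (cs.simple i)) = cs.length z.1 + 1 := by
    rw [length_mul_star, cs.inv_simple, h.length_eq]
  have h2 : ¬ cs.IsLeftInversion (z.1 * θ.toMulEquiv (cs.simple i)) (cs.simple i) := by
    rw [cs.isLeftInversion_mul_iff (cs.isReflection_simple i)]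
    obtain ⟨j, hj⟩ := θ.exists_star_simple i
    rw [hj, isLeftInversion_simple_iff, ← hj]
    have h3 : ¬ z.1⁻¹ * cs.simple i * z.1 = θ.toMulEquiv (cs.simple i) := by
      intro h'
      apply hc
      rw [Comm, ← h']; group
    have := h
    unfold Up at this
    tauto
  rw [cs.length_simple_mul_of_up h2, h1]

theorem Up.lt_length_ltimes {i : B} {z : θ.TwistedInv} (h : θ.Up i z) :
    cs.length z.1 < cs.length (θ.ltimes i z).1 := by
  by_cases hc : θ.Comm i z.1
  · rw [ltimes_of_comm hc, h.length_eq]; omega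
  · rw [h.length_of_not_comm hc]; omega

theorem Up.not_up_ltimes {i : B} {z : θ.TwistedInv} (h : θ.Up i z) : ¬ θ.Up i (θ.ltimes i z) := by
  rw [not_up_iff]
  by_cases hc : θ.Comm i z.1
  · rw [ltimes_of_comm hc, cs.simple_mul_simple_cancel_left, h.length_eq]; omega
  · rw [h.length_of_not_comm hc, ltimes_of_not_comm hc, mul_assoc, cs.simple_mul_simple_cancel_left,
      length_mul_star, cs.inv_simple, h.length_eq]
    omega

theorem up_ltimes_iff {i : B} {z : θ.TwistedInv} : θ.Up i (θ.ltimes i z) ↔ ¬ θ.Up i z := by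
  refine ⟨fun h h' => h'.not_up_ltimes h, fun h => ?_⟩
  by_contra hn
  rw [not_up_iff] at h hn
  by_cases hc : θ.Comm i z.1
  · rw [ltimes_of_comm hc, cs.simple_mul_simple_cancel_left] at hn
    omega
  · rw [ltimes_of_not_comm hc, mul_assoc, cs.simple_mul_simple_cancel_left, ← mul_assoc,
      length_mul_star, cs.inv_simple] at hn
    -- `s z > s z s^*` would force `s` and `z` to commute
    have h2 : cs.IsLeftInversion (cs.simple i * z.1 * θ.toMulEquiv (cs.simple i)) (cs.simple i) := by
      refine ⟨cs.isReflection_simple i, ?_⟩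
      rw [mul_assoc, cs.simple_mul_simple_cancel_left, ← mul_assoc, length_mul_star, cs.inv_simple]
      exact hn
    rw [cs.isLeftInversion_mul_iff (cs.isReflection_simple i)] at h2
    have h3 : ¬ cs.IsLeftInversion (cs.simple i * z.1) (cs.simple i) := by
      rintro ⟨_, h4⟩
      rw [cs.simple_mul_simple_cancel_left] at h4
      omega
    obtain ⟨j, hj⟩ := θ.exists_star_simple i
    rw [hj, isLeftInversion_simple_iff, ← hj] at h2
    apply hc
    have h4 : (cs.simple i * z.1)⁻¹ * cs.simple i * (cs.simple i * z.1) =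
      θ.toMulEquiv (cs.simple i) := by tauto
    rw [Comm, ← h4]
    simp [mul_assoc]

theorem length_ltimes_lt {i : B} {z : θ.TwistedInv} (h : ¬ θ.Up i z) :
    cs.length (θ.ltimes i z).1 < cs.length z.1 := by
  have := (up_ltimes_iff.2 h).lt_length_ltimes
  rwa [ltimes_ltimes] at this

/-! ## Double cosets of parabolic subgroups -/

section DoubleCoset

variable {J : Set B} {d : θ.TwistedInv}

/-- By the cocycle property the inversion comes from one of the three factors. `w` is excluded by
hypothesis and `d` has no inversions in `W_J`, so it comes from `c^*`. -/
theorem exists_of_isLeftInversion_mul_star (hd : ∀ i ∈ J, θ.Up i d) {w c t : W}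
    (hw : w ∈ cs.parabolic J) (hc : c ∈ cs.parabolic J) (ht : t ∈ cs.parabolic J)
    (hwt : ¬ cs.IsLeftInversion w t) (h : cs.IsLeftInversion (w * d.1 * θ.toMulEquiv c) t) :
    ∃ b ∈ cs.parabolic J, w⁻¹ * t * w * d.1 = d.1 * θ.toMulEquiv b ∧ cs.IsLeftInversion c b := by
  have htr := h.1
  rw [mul_assoc, cs.isLeftInversion_mul_iff htr] at h
  have h1 : cs.IsLeftInversion (d.1 * θ.toMulEquiv c) (w⁻¹ * t * w) := by tauto
  have h2 := not_isLeftInversion_of_no_descent hd (mul_mem (mul_mem (inv_mem hw) ht) hw)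
  rw [cs.isLeftInversion_mul_iff h1.1] at h1
  have h3 : cs.IsLeftInversion (θ.toMulEquiv c) (d.1⁻¹ * (w⁻¹ * t * w) * d.1) := by tauto
  have h4 := θ.isLeftInversion_star h3
  refine ⟨_, mem_parabolic_of_isLeftInversion hc h4, ?_, h4⟩
  rw [θ.star_star]; group

theorem eq_mul_star_of_comm {w c t : W}
    (h : t * (w * d.1 * θ.toMulEquiv c) = w * d.1 * θ.toMulEquiv c * θ.toMulEquiv t) :
    w⁻¹ * t * w * d.1 = d.1 * θ.toMulEquiv (c * t * c⁻¹) := by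
  rw [map_mul, map_mul, map_inv]
  calc _ = w⁻¹ * (t * (w * d.1 * θ.toMulEquiv c)) * (θ.toMulEquiv c)⁻¹ := by group
    _ = _ := by rw [h]; group

/-- Reduces relations `a d = d c^*` in `W_J` to simple reflections. A descent `s_k` of `a` is an
inversion of `d c^*`, so `s_k d = d b^*`; as `ℓ(d b^*) = ℓ(d) + ℓ(b)`, the element `b` has length
one. -/
theorem exists_simple_mul_eq_mul_star (hd : ∀ i ∈ J, θ.Up i d) {a c : W}
    (ha : a ∈ cs.parabolic J) (ha1 : a ≠ 1) (hc : c ∈ cs.parabolic J)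
    (h : a * d.1 = d.1 * θ.toMulEquiv c) :
    ∃ k ∈ J, cs.IsLeftInversion a (cs.simple k) ∧
      ∃ l ∈ J, cs.simple k * d.1 = d.1 * θ.toMulEquiv (cs.simple l) := by
  obtain ⟨k, hk, hinv⟩ := exists_descent_of_mem_parabolic ha ha1
  refine ⟨k, hk, hinv, ?_⟩
  have h1 := (isLeftInversion_mul_of_no_descent hd ha (cs.isReflection_simple k)
    (simple_mem_parabolic hk)).2 hinv
  have h2 : cs.IsLeftInversion (1 * d.1 * θ.toMulEquiv c) (cs.simple k) := by rwa [one_mul, ← h]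
  obtain ⟨b, hb, hb1, -⟩ := exists_of_isLeftInversion_mul_star hd (one_mem _) hc
    (simple_mem_parabolic hk) (by simp [IsLeftInversion]) h2
  rw [inv_one, one_mul, mul_one] at hb1
  have hl := (hd k hk).length_eq
  rw [hb1, length_mul_star, length_mul_of_no_descent hd (inv_mem hb), cs.length_inv] at hl
  have hb2 : b ≠ 1 := by rintro rfl; simp at hl
  obtain ⟨l, hl1, hl2⟩ := exists_descent_of_mem_parabolic hb hb2
  have h5 := hl2.2
  have h6 : cs.length (cs.simple l * b) = 0 := by omega
  rw [cs.length_eq_zero_iff] at h6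
  rw [← cs.inv_simple l, inv_mul_eq_one] at h6
  exact ⟨l, hl1, by rw [hb1, h6]⟩

/-- A descent at `k` and a commutation with `s_k` would each produce a relation of the kind that `H`
excludes. -/
theorem up_and_not_comm_of_forall_ne (hd : ∀ i ∈ J, θ.Up i d) {w c : W}
    (hw : w ∈ cs.parabolic J) (hc : c ∈ cs.parabolic J) {k : B} (hk : k ∈ J)
    (hwk : ¬ cs.IsLeftInversion w (cs.simple k)) {z : θ.TwistedInv}
    (hz : z.1 = w * d.1 * θ.toMulEquiv c)
    (H : ∀ b ∈ cs.parabolic J, w⁻¹ * cs.simple k * w * d.1 ≠ d.1 * θ.toMulEquiv b) :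
    θ.Up k z ∧ ¬ θ.Comm k z.1 := by
  have hk' := simple_mem_parabolic (cs := cs) hk
  constructor
  · intro h
    rw [hz] at h
    obtain ⟨b, hb, hb1, -⟩ := exists_of_isLeftInversion_mul_star hd hw hc hk' hwk h
    exact H b hb hb1
  · intro h
    rw [Comm, hz] at h
    exact H _ (mul_mem (mul_mem hc hk') (inv_mem hc)) (eq_mul_star_of_comm h)

end DoubleCoset

end CoxeterInvolution

namespace CoxeterInvolution

open CoxeterSystem

variable {B : Type u} {W : Type v} [Group W] {M : CoxeterMatrix B} {cs : CoxeterSystem M W}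
  {θ : CoxeterInvolution cs}

/-! ## Orbits of rank two -/

variable (θ) in
/-- The twisted involutions `i ⋉ d`, `j ⋉ (i ⋉ d)`, `i ⋉ (j ⋉ (i ⋉ d))`, …. -/
noncomputable def chain (i j : B) (d : θ.TwistedInv) : ℕ → θ.TwistedInv
  | 0 => d
  | k + 1 => θ.ltimes (altLetter i j k) (chain i j d k)

theorem chain_succ (i j : B) (d : θ.TwistedInv) (k : ℕ) :
    θ.chain i j d (k + 1) = θ.ltimes (altLetter i j k) (θ.chain i j d k) := rfl

variable {i j : B} {d : θ.TwistedInv}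

theorem altLetter_mem {J : Set B} (hi : i ∈ J) (hj : j ∈ J) (k : ℕ) : altLetter i j k ∈ J := by
  rcases altLetter_cases i j k with h | h <;> rw [h.1] <;> assumption

theorem altMul_mem_parabolic {J : Set B} (hi : i ∈ J) (hj : j ∈ J) (k : ℕ) :
    altMul (cs.simple i) (cs.simple j) k ∈ cs.parabolic J :=
  altMul_mem (simple_mem_parabolic hi) (simple_mem_parabolic hj) k

/-! ### No simple reflection is conjugated into the parabolic subgroup -/

theorem chain_of_free {J : Set B} (hd : ∀ l ∈ J, θ.Up l d) (hi : i ∈ J) (hj : j ∈ J)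
    (H : ∀ a ∈ cs.parabolic J, ∀ b ∈ cs.parabolic J, a * d.1 = d.1 * θ.toMulEquiv b → a = 1)
    {k : ℕ} (hk : k ≤ orderOf (cs.simple i * cs.simple j)) :
    (θ.chain i j d k).1 = altMul (cs.simple i) (cs.simple j) k * d.1 *
        θ.toMulEquiv (altMul (cs.simple i) (cs.simple j) k)⁻¹ ∧
      (k < orderOf (cs.simple i * cs.simple j) → θ.Up (altLetter i j k) (θ.chain i j d k) ∧
        ¬ θ.Comm (altLetter i j k) (θ.chain i j d k).1) := by
  -- The formula at `k` rules out commutation at `k`, and this in turn yields the formula at `k +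
  -- 1`; hence `key` is separated from the induction. The later chain lemmas follow the same scheme.
  have key : ∀ {k : ℕ}, (θ.chain i j d k).1 = altMul (cs.simple i) (cs.simple j) k * d.1 *
        θ.toMulEquiv (altMul (cs.simple i) (cs.simple j) k)⁻¹ →
      (k < orderOf (cs.simple i * cs.simple j) → θ.Up (altLetter i j k) (θ.chain i j d k) ∧
        ¬ θ.Comm (altLetter i j k) (θ.chain i j d k).1) := by
    intro k hz hk
    have hw := altMul_mem_parabolic (cs := cs) hi hj k
    have hn := not_isLeftInversion_altMul (cs := cs) (Or.inr hk)
    rw [← apply_altLetter _ _ cs.simple] at hn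
    refine up_and_not_comm_of_forall_ne hd hw (inv_mem hw) (altLetter_mem hi hj k) hn hz ?_
    intro b hb h
    have h1 := H _ (mul_mem (mul_mem (inv_mem hw) (simple_mem_parabolic (altLetter_mem hi hj k))) hw)
      b hb h
    rw [mul_assoc, inv_mul_eq_one] at h1
    have := cs.length_simple_mul_ne (altMul (cs.simple i) (cs.simple j) k) (altLetter i j k)
    exact this (by rw [← h1])
  have hz : (θ.chain i j d k).1 = altMul (cs.simple i) (cs.simple j) k * d.1 *
        θ.toMulEquiv (altMul (cs.simple i) (cs.simple j) k)⁻¹ := by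
    induction k with
    | zero => simp [chain]
    | succ k ih =>
      have hz := ih (by omega)
      rw [chain_succ, ltimes_of_not_comm (key hz (by omega)).2, hz, altMul_succ,
        ← apply_altLetter _ _ cs.simple]
      simp only [mul_inv_rev, map_mul, cs.inv_simple, mul_assoc]
  exact ⟨hz, key hz⟩

/-! ### One simple reflection is conjugated into the parabolic subgroup -/

section One

variable {J : Set B} (hd : ∀ l ∈ J, θ.Up l d) (hi : i ∈ J) (hj : j ∈ J)
  (H : ∀ a ∈ cs.parabolic J, ∀ b ∈ cs.parabolic J, a * d.1 = d.1 * θ.toMulEquiv b →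
    a = 1 ∨ a = cs.simple i)
  (hc : θ.Comm i d.1)

include hd hi hj H

/-- A commutation at step `k` would conjugate the next letter to `s_i`, that is, identify the two
alternating products with `k + 1` factors. -/
theorem chain_of_comm_right {k : ℕ} (hk : k + 1 ≤ orderOf (cs.simple i * cs.simple j)) :
    (θ.chain j i d k).1 = altMul (cs.simple j) (cs.simple i) k * d.1 *
        θ.toMulEquiv (altMul (cs.simple j) (cs.simple i) k)⁻¹ ∧
      (k + 1 < orderOf (cs.simple i * cs.simple j) →
        θ.Up (altLetter j i k) (θ.chain j i d k) ∧
        ¬ θ.Comm (altLetter j i k) (θ.chain j i d k).1) := by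
  have key : ∀ {k : ℕ}, (θ.chain j i d k).1 = altMul (cs.simple j) (cs.simple i) k * d.1 *
        θ.toMulEquiv (altMul (cs.simple j) (cs.simple i) k)⁻¹ →
      k + 1 < orderOf (cs.simple i * cs.simple j) →
        θ.Up (altLetter j i k) (θ.chain j i d k) ∧
        ¬ θ.Comm (altLetter j i k) (θ.chain j i d k).1 := by
    intro k hz hk
    have hw := altMul_mem_parabolic (cs := cs) hj hi k
    have hn := not_isLeftInversion_altMul (cs := cs) (i := j) (j := i) (k := k)
      (Or.inr (by rw [orderOf_simple_mul_comm]; omega))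
    rw [← apply_altLetter _ _ cs.simple] at hn
    refine up_and_not_comm_of_forall_ne hd hw (inv_mem hw) (altLetter_mem hj hi _) hn hz ?_
    intro b hb h
    rcases H _ (mul_mem (mul_mem (inv_mem hw) (simple_mem_parabolic (altLetter_mem hj hi _))) hw)
      b hb h with h1 | h1
    · rw [mul_assoc, inv_mul_eq_one] at h1
      exact cs.length_simple_mul_ne _ (altLetter j i k) (by rw [← h1])
    · rw [mul_assoc, inv_mul_eq_iff_eq_mul, apply_altLetter _ _ cs.simple, ← altMul_succ,
        ← altMul_succ'] at h1
      exact altMul_ne (by omega) hk h1.symm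
  have hz : (θ.chain j i d k).1 = altMul (cs.simple j) (cs.simple i) k * d.1 *
        θ.toMulEquiv (altMul (cs.simple j) (cs.simple i) k)⁻¹ := by
    induction k with
    | zero => simp [chain]
    | succ k ih =>
      have hz := ih (by omega)
      rw [chain_succ, ltimes_of_not_comm (key hz (by omega)).2, hz, altMul_succ,
        ← apply_altLetter _ _ cs.simple]
      simp only [mul_inv_rev, map_mul, cs.inv_simple, mul_assoc]
  exact ⟨hz, key hz⟩

include hc

/-- The commuting first step multiplies on the left only, so the left factor stays one letter longer
than the right one. A later commutation would equate alternating products with `k + 2` and `k`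
factors. -/
theorem chain_of_comm_left {k : ℕ} (hk : k + 1 ≤ orderOf (cs.simple i * cs.simple j)) :
    (θ.chain i j d (k + 1)).1 = altMul (cs.simple i) (cs.simple j) (k + 1) * d.1 *
        θ.toMulEquiv (altMul (cs.simple j) (cs.simple i) k)⁻¹ ∧
      (k + 1 < orderOf (cs.simple i * cs.simple j) →
        θ.Up (altLetter i j (k + 1)) (θ.chain i j d (k + 1)) ∧
        ¬ θ.Comm (altLetter i j (k + 1)) (θ.chain i j d (k + 1)).1) := by
  have key : ∀ {k : ℕ}, (θ.chain i j d (k + 1)).1 =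
      altMul (cs.simple i) (cs.simple j) (k + 1) * d.1 *
        θ.toMulEquiv (altMul (cs.simple j) (cs.simple i) k)⁻¹ →
      k + 1 < orderOf (cs.simple i * cs.simple j) →
        θ.Up (altLetter i j (k + 1)) (θ.chain i j d (k + 1)) ∧
        ¬ θ.Comm (altLetter i j (k + 1)) (θ.chain i j d (k + 1)).1 := by
    intro k hz hk
    have hw := altMul_mem_parabolic (cs := cs) hi hj (k + 1)
    have hw' := altMul_mem_parabolic (cs := cs) hj hi k
    have hn := not_isLeftInversion_altMul (cs := cs) (Or.inr hk)
    rw [← apply_altLetter _ _ cs.simple] at hn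
    refine up_and_not_comm_of_forall_ne hd hw (inv_mem hw') (altLetter_mem hi hj _) hn hz ?_
    intro b hb h
    rcases H _ (mul_mem (mul_mem (inv_mem hw) (simple_mem_parabolic (altLetter_mem hi hj _))) hw)
      b hb h with h1 | h1
    · rw [mul_assoc, inv_mul_eq_one] at h1
      exact cs.length_simple_mul_ne _ (altLetter i j (k + 1)) (by rw [← h1])
    · rw [mul_assoc, inv_mul_eq_iff_eq_mul, apply_altLetter _ _ cs.simple, ← altMul_succ,
        altMul_succ' _ _ k, cs.simple_mul_simple_cancel_right] at h1
      have h2 := congrArg cs.length h1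
      rw [length_altMul (Or.inr (by omega)),
        length_altMul (Or.inr (by rw [orderOf_simple_mul_comm]; omega))] at h2
      omega
  have hz : (θ.chain i j d (k + 1)).1 = altMul (cs.simple i) (cs.simple j) (k + 1) * d.1 *
        θ.toMulEquiv (altMul (cs.simple j) (cs.simple i) k)⁻¹ := by
    induction k with
    | zero => simp [chain, ltimes_of_comm hc]
    | succ k ih =>
      have hz := ih (by omega)
      rw [chain_succ, ltimes_of_not_comm (key hz (by omega)).2, hz, altMul_succ _ _ (k + 1),
        altMul_succ _ _ k, altMul_succ _ _ k, altLetter_succ, apply_altLetter _ _ cs.simple]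
      have hinv : (altLetter (cs.simple j) (cs.simple i) k)⁻¹ =
          altLetter (cs.simple j) (cs.simple i) k := by
        rw [← apply_altLetter _ _ cs.simple, cs.inv_simple]
      simp only [mul_inv_rev, map_mul, hinv, mul_assoc, altLetter_succ]
  exact ⟨hz, key hz⟩

/-- At the order, the next letter times the alternating product `p` equals `p s_i`, and `s_i` passes
through `d`. So the last step commutes and gives `p s_i d (p⁻¹)^*`, the end of the other chain. -/
theorem chain_of_comm_right_top {n : ℕ} (hn : orderOf (cs.simple i * cs.simple j) = n + 1) :
    θ.Up (altLetter j i n) (θ.chain j i d n) ∧ θ.Comm (altLetter j i n) (θ.chain j i d n).1 ∧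
      θ.chain i j d (n + 1) = θ.chain j i d (n + 1) := by
  have hz := (chain_of_comm_right hd hi hj H (k := n) hn.ge).1
  have hw := altMul_mem_parabolic (cs := cs) hj hi n
  have hl := simple_mem_parabolic (cs := cs) (altLetter_mem hj hi n)
  have hr : cs.simple (altLetter j i n) * altMul (cs.simple j) (cs.simple i) n =
      altMul (cs.simple j) (cs.simple i) n * cs.simple i := by
    rw [apply_altLetter _ _ cs.simple, ← altMul_succ, ← altMul_succ', ← hn, ← altMul_orderOf]
  have hcomm : θ.Comm (altLetter j i n) (θ.chain j i d n).1 := by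
    have h1 : (altMul (cs.simple j) (cs.simple i) n)⁻¹ * cs.simple (altLetter j i n) =
        cs.simple i * (altMul (cs.simple j) (cs.simple i) n)⁻¹ := by
      rw [inv_mul_eq_iff_eq_mul, ← mul_assoc, ← hr, mul_inv_cancel_right]
    rw [Comm, hz, ← mul_assoc, ← mul_assoc, hr, mul_assoc _ (cs.simple i), hc, mul_assoc _ _
      (θ.toMulEquiv (cs.simple (altLetter j i n))), ← map_mul, h1, map_mul]
    simp only [mul_assoc]
  refine ⟨?_, hcomm, ?_⟩
  · intro h
    have hnw := not_isLeftInversion_altMul (cs := cs) (i := j) (j := i) (k := n)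
      (Or.inr (by rw [orderOf_simple_mul_comm]; omega))
    rw [← apply_altLetter _ _ cs.simple] at hnw
    rw [hz] at h
    obtain ⟨b, hb, hb1, hb2⟩ := exists_of_isLeftInversion_mul_star hd hw (inv_mem hw) hl hnw h
    rw [mul_assoc _ _ (altMul _ _ _), hr, inv_mul_cancel_left, hc, mul_right_inj,
      θ.toMulEquiv.injective.eq_iff] at hb1
    have h2 := hb2.2
    rw [← hb1, ← cs.length_inv, mul_inv_rev, inv_inv, cs.inv_simple, ← altMul_succ', cs.length_inv,
      length_altMul (Or.inr hn.ge), length_altMul (Or.inr (by rw [orderOf_simple_mul_comm]; omega))] at h2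
    omega
  · apply Subtype.ext
    rw [(chain_of_comm_left hd hi hj H hc (k := n) hn.ge).1, chain_succ, ltimes_of_comm hcomm,
      hz, ← mul_assoc, ← mul_assoc, hr, ← altMul_succ', mul_assoc]

end One

/-! ### The parabolic subgroup is conjugated to itself -/

section Two

variable {J : Set B} (hd : ∀ l ∈ J, θ.Up l d) (hi : i ∈ J) (hj : j ∈ J)

include hd hi hj in
theorem length_altMul_mul {k : ℕ} (hk : k ≤ orderOf (cs.simple i * cs.simple j)) :
    cs.length (altMul (cs.simple i) (cs.simple j) k * d.1) = k + cs.length d.1 := by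
  rw [length_mul_of_no_descent hd (altMul_mem_parabolic hi hj k), length_altMul (Or.inr hk)]

variable (i j) in
theorem orderOf_altLetter (k : ℕ) :
    orderOf (cs.simple (altLetter i j k) * cs.simple (altLetter j i k)) =
      orderOf (cs.simple i * cs.simple j) := by
  rcases altLetter_cases i j k with h | h <;> rw [h.1, h.2]
  rw [orderOf_simple_mul_comm]

include hd hi hj in
theorem up_of_eq_altMul_mul {z : θ.TwistedInv} {n : ℕ}
    (hn : n < orderOf (cs.simple i * cs.simple j))
    (hz : z.1 = altMul (cs.simple i) (cs.simple j) n * d.1) : θ.Up (altLetter i j n) z := by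
  rw [up_iff, hz, apply_altLetter _ _ cs.simple, ← mul_assoc, ← altMul_succ,
    length_altMul_mul hd hi hj hn, length_altMul_mul hd hi hj hn.le]
  omega

/-- The case where `d` commutes with both simple reflections. -/
theorem chain_of_comm_comm (hd : ∀ l ∈ J, θ.Up l d) (hi : i ∈ J) (hj : j ∈ J)
    (hci : θ.Comm i d.1) (hcj : θ.Comm j d.1) {k : ℕ}
    (hk : 2 * k + 1 ≤ orderOf (cs.simple i * cs.simple j)) :
    (θ.chain i j d (k + 1)).1 =
        altMul (cs.simple (altLetter i j k)) (cs.simple (altLetter j i k)) (2 * k + 1) * d.1 ∧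
      (2 * k + 1 < orderOf (cs.simple i * cs.simple j) →
        θ.Up (altLetter i j (k + 1)) (θ.chain i j d (k + 1)) ∧
        (θ.Comm (altLetter i j (k + 1)) (θ.chain i j d (k + 1)).1 ↔
          2 * k + 2 = orderOf (cs.simple i * cs.simple j))) := by
  have hcc : ∀ k, cs.simple (altLetter i j k) * d.1 =
      d.1 * θ.toMulEquiv (cs.simple (altLetter i j k)) := by
    intro k; rcases altLetter_cases i j k with h | h <;> rw [h.1] <;> assumption
  have key : ∀ {k : ℕ}, (θ.chain i j d (k + 1)).1 =
        altMul (cs.simple (altLetter i j k)) (cs.simple (altLetter j i k)) (2 * k + 1) * d.1 →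
      (2 * k + 1 < orderOf (cs.simple i * cs.simple j) →
        θ.Up (altLetter i j (k + 1)) (θ.chain i j d (k + 1)) ∧
        (θ.Comm (altLetter i j (k + 1)) (θ.chain i j d (k + 1)).1 ↔
          2 * k + 2 = orderOf (cs.simple i * cs.simple j))) := by
    intro k hz hk
    have hlet : altLetter (altLetter i j k) (altLetter j i k) (2 * k + 1) =
        altLetter i j (k + 1) := by
      rw [altLetter_succ, altLetter_two_mul, altLetter_succ]
    constructor
    · have := up_of_eq_altMul_mul hd (altLetter_mem hi hj k) (altLetter_mem hj hi k)
        (by rw [orderOf_altLetter]; exact hk) hz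
      rwa [hlet] at this
    -- Once the right factor is moved across `d`, commutation says that the two alternating products
    -- with `2 * k + 2` factors agree.
    · rw [Comm, hz, mul_assoc _ d.1, ← hcc, ← mul_assoc, ← mul_assoc, mul_left_inj, ← hlet,
        apply_altLetter _ _ cs.simple, ← altMul_succ, ← apply_altLetter _ _ cs.simple, hlet,
        altLetter_succ, ← altMul_succ']
      constructor
      · intro h
        by_contra hne
        exact altMul_ne (by omega) (by rw [orderOf_altLetter]; omega) h
      · intro h
        rw [h, ← orderOf_altLetter i j k, altMul_orderOf]
  have hz : (θ.chain i j d (k + 1)).1 =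
        altMul (cs.simple (altLetter i j k)) (cs.simple (altLetter j i k)) (2 * k + 1) * d.1 := by
    induction k with
    | zero => simp [chain, ltimes_of_comm hci]
    | succ k ih =>
      have hz := ih (by omega)
      have hnc : ¬ θ.Comm (altLetter i j (k + 1)) (θ.chain i j d (k + 1)).1 := by
        rw [(key hz (by omega)).2]; omega
      rw [chain_succ, ltimes_of_not_comm hnc, hz, mul_assoc, mul_assoc, ← hcc, altLetter_succ,
        altLetter_succ, ← mul_assoc, ← mul_assoc, mul_assoc (cs.simple _), ← altMul_succ',
        show 2 * (k + 1) + 1 = (2 * k + 1 + 1) + 1 by ring, altMul_succ _ _ (2 * k + 1 + 1)]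
      congr 2
      rw [altLetter_succ, altLetter_succ, altLetter_two_mul]
  exact ⟨hz, key hz⟩

/-- The case where conjugation by `d` swaps the simple reflections. -/
theorem chain_of_swap (hd : ∀ l ∈ J, θ.Up l d) (hi : i ∈ J) (hj : j ∈ J)
    (hij : cs.simple i * d.1 = d.1 * θ.toMulEquiv (cs.simple j))
    (hji : cs.simple j * d.1 = d.1 * θ.toMulEquiv (cs.simple i)) {k : ℕ}
    (hk : 2 * k ≤ orderOf (cs.simple i * cs.simple j)) :
    (θ.chain i j d k).1 =
        altMul (cs.simple (altLetter i j k)) (cs.simple (altLetter j i k)) (2 * k) * d.1 ∧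
      (2 * k < orderOf (cs.simple i * cs.simple j) →
        θ.Up (altLetter i j k) (θ.chain i j d k) ∧
        (θ.Comm (altLetter i j k) (θ.chain i j d k).1 ↔
          2 * k + 1 = orderOf (cs.simple i * cs.simple j))) := by
  have hcc : ∀ k, cs.simple (altLetter j i k) * d.1 =
      d.1 * θ.toMulEquiv (cs.simple (altLetter i j k)) := by
    intro k; rcases altLetter_cases i j k with h | h <;> rw [h.1, h.2] <;> assumption
  have key : ∀ {k : ℕ}, (θ.chain i j d k).1 =
        altMul (cs.simple (altLetter i j k)) (cs.simple (altLetter j i k)) (2 * k) * d.1 →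
      (2 * k < orderOf (cs.simple i * cs.simple j) →
        θ.Up (altLetter i j k) (θ.chain i j d k) ∧
        (θ.Comm (altLetter i j k) (θ.chain i j d k).1 ↔
          2 * k + 1 = orderOf (cs.simple i * cs.simple j))) := by
    intro k hz hk
    have hlet : altLetter (altLetter i j k) (altLetter j i k) (2 * k) = altLetter i j k := by
      rw [altLetter_two_mul]
    have hlet' : altLetter (cs.simple (altLetter i j k)) (cs.simple (altLetter j i k)) (2 * k) =
      cs.simple (altLetter i j k) := by rw [altLetter_two_mul]
    constructor
    · have := up_of_eq_altMul_mul hd (altLetter_mem hi hj k) (altLetter_mem hj hi k)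
        (by rw [orderOf_altLetter]; exact hk) hz
      rwa [hlet] at this
    · rw [Comm, hz, mul_assoc _ d.1, ← hcc, ← mul_assoc, ← mul_assoc, mul_left_inj, ← altMul_succ']
      conv_lhs => lhs; lhs; rw [← hlet']
      rw [← altMul_succ]
      constructor
      · intro h
        by_contra hne
        exact altMul_ne (by omega) (by rw [orderOf_altLetter]; omega) h
      · intro h
        rw [h, ← orderOf_altLetter i j k, altMul_orderOf]
  have hz : (θ.chain i j d k).1 =
        altMul (cs.simple (altLetter i j k)) (cs.simple (altLetter j i k)) (2 * k) * d.1 := by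
    induction k with
    | zero => simp [chain]
    | succ k ih =>
      have hz := ih (by omega)
      have hnc : ¬ θ.Comm (altLetter i j k) (θ.chain i j d k).1 := by
        rw [(key hz (by omega)).2]; omega
      rw [chain_succ, ltimes_of_not_comm hnc, hz, mul_assoc, mul_assoc, ← hcc, altLetter_succ,
        altLetter_succ, ← mul_assoc, ← mul_assoc, mul_assoc (cs.simple _), ← altMul_succ',
        show 2 * (k + 1) = (2 * k + 1) + 1 by ring, altMul_succ _ _ (2 * k + 1)]
      congr 2
      rw [altLetter_succ, altLetter_two_mul]
  exact ⟨hz, key hz⟩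

end Two

end CoxeterInvolution

/-! ### The possible shapes of a rank two orbit. -/

namespace CoxeterInvolution

open CoxeterSystem

variable {B : Type u} {W : Type v} [Group W] {M : CoxeterMatrix B} {cs : CoxeterSystem M W}
  {θ : CoxeterInvolution cs}

theorem star_swap {d : θ.TwistedInv} {x y : W} (hx : x⁻¹ = x) (hy : y⁻¹ = y)
    (h : x * d.1 = d.1 * θ.toMulEquiv y) :
    y * d.1 = d.1 * θ.toMulEquiv x := by
  have := congrArg (fun z => (θ.toMulEquiv z)⁻¹) h
  simp only [map_mul, d.2, θ.star_star, mul_inv_rev, inv_inv, hy] at this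
  rw [← map_inv, hx] at this
  exact this.symm

/-- The structure of the orbit of a twisted involution without left descents among `i`, `j`: the
two chains starting at `d` are increasing and have a common top, and the commuting steps can occur
only at the ends. -/
theorem exists_orbit_top {i j : B} {d : θ.TwistedInv} (hdi : θ.Up i d) (hdj : θ.Up j d)
    {m : ℕ} (hm : m = orderOf (cs.simple i * cs.simple j)) (h1 : 1 < m) :
    ∃ p, 0 < p ∧ θ.chain i j d p = θ.chain j i d p ∧
      (∀ k < p, θ.Up (altLetter i j k) (θ.chain i j d k)) ∧
      (∀ k < p, θ.Up (altLetter j i k) (θ.chain j i d k)) ∧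
      -- The alternatives in order: no relation `s d = d t^*` with `s, t` among the two reflections
      -- (`m = p`), or `d` swaps them and `m` is even; only `i` commutes with `d`; only `j` does;
      -- both do and `m` is odd; both do and `m` is even; `d` swaps them and `m` is odd.
      ((m = p ∨ m = 2 * p) ∧
          (∀ k < p, ¬ θ.Comm (altLetter i j k) (θ.chain i j d k).1) ∧
          (∀ k < p, ¬ θ.Comm (altLetter j i k) (θ.chain j i d k).1) ∨
        m = p ∧
          (∀ k < p, θ.Comm (altLetter i j k) (θ.chain i j d k).1 ↔ k = 0) ∧
          (∀ k < p, θ.Comm (altLetter j i k) (θ.chain j i d k).1 ↔ k + 1 = p) ∨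
        m = p ∧
          (∀ k < p, θ.Comm (altLetter i j k) (θ.chain i j d k).1 ↔ k + 1 = p) ∧
          (∀ k < p, θ.Comm (altLetter j i k) (θ.chain j i d k).1 ↔ k = 0) ∨
        m + 1 = 2 * p ∧
          (∀ k < p, θ.Comm (altLetter i j k) (θ.chain i j d k).1 ↔ k = 0) ∧
          (∀ k < p, θ.Comm (altLetter j i k) (θ.chain j i d k).1 ↔ k = 0) ∨
        m + 2 = 2 * p ∧
          (∀ k < p, θ.Comm (altLetter i j k) (θ.chain i j d k).1 ↔ k = 0 ∨ k + 1 = p) ∧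
          (∀ k < p, θ.Comm (altLetter j i k) (θ.chain j i d k).1 ↔ k = 0 ∨ k + 1 = p) ∨
        m + 1 = 2 * p ∧
          (∀ k < p, θ.Comm (altLetter i j k) (θ.chain i j d k).1 ↔ k + 1 = p) ∧
          (∀ k < p, θ.Comm (altLetter j i k) (θ.chain j i d k).1 ↔ k + 1 = p)) := by
  set J : Set B := {i, j} with hJ
  have hi : i ∈ J := by simp [hJ]
  have hj : j ∈ J := by simp [hJ]
  have hd : ∀ l ∈ J, θ.Up l d := by
    rintro l (rfl | rfl) <;> assumption
  have hm' : m = orderOf (cs.simple j * cs.simple i) := by rw [hm, orderOf_simple_mul_comm]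
  -- an element of the parabolic subgroup carried into it by `d` starts with a simple reflection
  have hL : ∀ a ∈ cs.parabolic J, ∀ b ∈ cs.parabolic J, a * d.1 = d.1 * θ.toMulEquiv b → a ≠ 1 →
      (cs.IsLeftInversion a (cs.simple i) ∧ θ.Comm i d.1) ∨
      (cs.IsLeftInversion a (cs.simple j) ∧ θ.Comm j d.1) ∨
      cs.simple i * d.1 = d.1 * θ.toMulEquiv (cs.simple j) := by
    intro a ha b hb h ha1
    obtain ⟨k, hk, hinv, l, hl, e⟩ := exists_simple_mul_eq_mul_star hd ha ha1 hb h
    rcases hk with rfl | rfl <;> rcases hl with rfl | rfl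
    · exact Or.inl ⟨hinv, e⟩
    · exact Or.inr (Or.inr e)
    · exact Or.inr (Or.inr (star_swap (cs.inv_simple _) (cs.inv_simple _) e))
    · exact Or.inr (Or.inl ⟨hinv, e⟩)
  -- the case of one commuting simple reflection
  have hone : ∀ k : B, k ∈ J → θ.Comm k d.1 →
      (∀ a ∈ cs.parabolic J, ∀ b ∈ cs.parabolic J, a * d.1 = d.1 * θ.toMulEquiv b → a ≠ 1 →
        cs.IsLeftInversion a (cs.simple k)) →
      ∀ a ∈ cs.parabolic J, ∀ b ∈ cs.parabolic J, a * d.1 = d.1 * θ.toMulEquiv b →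
        a = 1 ∨ a = cs.simple k := by
    intro k hk hc h a ha b hb e
    by_contra hne
    push Not at hne
    have hinv := h a ha b hb e hne.1
    have hk' := simple_mem_parabolic (cs := cs) hk
    -- `d` also carries `s_k a` into the parabolic subgroup, but `s_k` cannot be a left descent of
    -- both `a` and `s_k a`.
    have e2 : cs.simple k * a * d.1 = d.1 * θ.toMulEquiv (cs.simple k * b) := by
      rw [mul_assoc, e, map_mul, ← mul_assoc, hc, mul_assoc]
    have hne' : cs.simple k * a ≠ 1 := by
      intro h'
      apply hne.2
      rw [eq_inv_of_mul_eq_one_right h', cs.inv_simple]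
    have := h _ (mul_mem hk' ha) _ (mul_mem hk' hb) e2 hne'
    exact (cs.isReflection_simple k).isLeftInversion_mul_right_iff.1 this hinv
  by_cases hsw : cs.simple i * d.1 = d.1 * θ.toMulEquiv (cs.simple j)
  · have hsw' := star_swap (cs.inv_simple _) (cs.inv_simple _) hsw
    have hX := fun (k : ℕ) => chain_of_swap (k := k) hd hi hj hsw hsw'
    have hY := fun (k : ℕ) => chain_of_swap (k := k) hd hj hi hsw' hsw
    rw [← hm] at hX
    rw [← hm'] at hY
    rcases Nat.even_or_odd' m with ⟨n, hn | hn⟩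
    · refine ⟨n, by omega, ?_, fun k hk => ((hX k (by omega)).2 (by omega)).1,
        fun k hk => ((hY k (by omega)).2 (by omega)).1, Or.inl ⟨Or.inr hn, fun k hk => ?_, fun k hk => ?_⟩⟩
      · apply Subtype.ext
        rw [(hX n (by omega)).1, (hY n (by omega)).1, ← hn, hm, ← orderOf_altLetter i j n,
          altMul_orderOf]
      · rw [((hX k (by omega)).2 (by omega)).2]; omega
      · rw [((hY k (by omega)).2 (by omega)).2]; omega
    · have hcX := ((hX n (by omega)).2 (by omega)).2.2 hn.symm
      have hcY := ((hY n (by omega)).2 (by omega)).2.2 hn.symm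
      refine ⟨n + 1, by omega, ?_, fun k hk => ((hX k (by omega)).2 (by omega)).1,
        fun k hk => ((hY k (by omega)).2 (by omega)).1,
        Or.inr (Or.inr (Or.inr (Or.inr (Or.inr ⟨by omega, fun k hk => ?_, fun k hk => ?_⟩))))⟩
      · apply Subtype.ext
        rw [chain_succ, chain_succ, ltimes_of_comm hcX, ltimes_of_comm hcY, (hX n (by omega)).1,
          (hY n (by omega)).1, ← mul_assoc, ← mul_assoc]
        have e : ∀ i j : B, m = orderOf (cs.simple i * cs.simple j) → cs.simple (altLetter i j n) *
            altMul (cs.simple (altLetter i j n)) (cs.simple (altLetter j i n)) (2 * n) =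
            altMul (cs.simple (altLetter i j n)) (cs.simple (altLetter j i n)) m := by
          intro i j hm
          rw [hn, altMul_succ, altLetter_two_mul]
        rw [e i j hm, e j i hm', hm, ← orderOf_altLetter i j n, altMul_orderOf]
      · rw [((hX k (by omega)).2 (by omega)).2]; omega
      · rw [((hY k (by omega)).2 (by omega)).2]; omega
  by_cases hci : θ.Comm i d.1 <;> by_cases hcj : θ.Comm j d.1
  · have hX := fun (k : ℕ) => chain_of_comm_comm (k := k) hd hi hj hci hcj
    have hY := fun (k : ℕ) => chain_of_comm_comm (k := k) hd hj hi hcj hci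
    rw [← hm] at hX
    rw [← hm'] at hY
    have hupX : ∀ k, 2 * k ≤ m → θ.Up (altLetter i j k) (θ.chain i j d k) := by
      rintro (_ | k) hk
      exacts [hdi, ((hX k (by omega)).2 (by omega)).1]
    have hupY : ∀ k, 2 * k ≤ m → θ.Up (altLetter j i k) (θ.chain j i d k) := by
      rintro (_ | k) hk
      exacts [hdj, ((hY k (by omega)).2 (by omega)).1]
    have hcX : ∀ k, 2 * k ≤ m → (θ.Comm (altLetter i j k) (θ.chain i j d k).1 ↔ k = 0 ∨ 2 * k = m) := by
      rintro (_ | k) hk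
      · exact iff_of_true hci (Or.inl rfl)
      · rw [((hX k (by omega)).2 (by omega)).2]; omega
    have hcY : ∀ k, 2 * k ≤ m → (θ.Comm (altLetter j i k) (θ.chain j i d k).1 ↔ k = 0 ∨ 2 * k = m) := by
      rintro (_ | k) hk
      · exact iff_of_true hcj (Or.inl rfl)
      · rw [((hY k (by omega)).2 (by omega)).2]; omega
    rcases Nat.even_or_odd' m with ⟨n, hn | hn⟩
    · obtain ⟨n, rfl⟩ : ∃ k, n = k + 1 := ⟨n - 1, by omega⟩
      refine ⟨n + 1 + 1, by omega, ?_, fun k hk => hupX k (by omega), fun k hk => hupY k (by omega),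
        Or.inr (Or.inr (Or.inr (Or.inr (Or.inl ⟨by omega, fun k hk => ?_, fun k hk => ?_⟩))))⟩
      · apply Subtype.ext
        rw [chain_succ i j d (n + 1), chain_succ j i d (n + 1), ltimes_of_comm ((hcX (n + 1) (by omega)).2 (by omega)),
          ltimes_of_comm ((hcY (n + 1) (by omega)).2 (by omega)), (hX n (by omega)).1,
          (hY n (by omega)).1, ← mul_assoc, ← mul_assoc]
        have e : ∀ i j : B, m = orderOf (cs.simple i * cs.simple j) → cs.simple (altLetter i j (n + 1)) *
            altMul (cs.simple (altLetter i j n)) (cs.simple (altLetter j i n)) (2 * n + 1) =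
            altMul (cs.simple (altLetter i j n)) (cs.simple (altLetter j i n)) m := by
          intro i j hm
          rw [hn, show 2 * (n + 1) = 2 * n + 1 + 1 by ring, altMul_succ _ _ (2 * n + 1), altLetter_succ,
            altLetter_succ, altLetter_two_mul]
        rw [e i j hm, e j i hm', hm, ← orderOf_altLetter i j n, altMul_orderOf]
      · rw [hcX k (by omega)]; omega
      · rw [hcY k (by omega)]; omega
    · refine ⟨n + 1, by omega, ?_, fun k hk => hupX k (by omega), fun k hk => hupY k (by omega),
        Or.inr (Or.inr (Or.inr (Or.inl ⟨by omega, fun k hk => ?_, fun k hk => ?_⟩)))⟩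
      · apply Subtype.ext
        rw [(hX n (by omega)).1, (hY n (by omega)).1, ← hn, hm, ← orderOf_altLetter i j n,
          altMul_orderOf]
      · rw [hcX k (by omega)]; omega
      · rw [hcY k (by omega)]; omega
  · have H := hone i hi hci (fun a ha b hb e ha1 => by
      rcases hL a ha b hb e ha1 with h | h | h <;> tauto)
    have hX := fun (k : ℕ) => chain_of_comm_left (k := k) hd hi hj H hci
    have hY := fun (k : ℕ) => chain_of_comm_right (k := k) hd hi hj H
    obtain ⟨n, rfl⟩ : ∃ n, m = n + 1 := ⟨m - 1, by omega⟩
    obtain ⟨t1, t2, t3⟩ := chain_of_comm_right_top hd hi hj H hci hm.symm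
    rw [← hm] at hX hY
    refine ⟨n + 1, by omega, t3, ?_, fun k hk => ?_, Or.inr (Or.inl ⟨rfl, ?_, fun k hk => ?_⟩)⟩
    · rintro (_ | k) hk
      exacts [hdi, ((hX k (by omega)).2 (by omega)).1]
    · by_cases h : k = n
      · rwa [h]
      · exact ((hY k (by omega)).2 (by omega)).1
    · rintro (_ | k) hk
      · exact iff_of_true hci rfl
      · exact iff_of_false ((hX k (by omega)).2 (by omega)).2 (by omega)
    · by_cases h : k = n
      · rw [h]; exact iff_of_true t2 rfl
      · exact iff_of_false ((hY k (by omega)).2 (by omega)).2 (by omega)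
  · have H := hone j hj hcj (fun a ha b hb e ha1 => by
      rcases hL a ha b hb e ha1 with h | h | h <;> tauto)
    have hY := fun (k : ℕ) => chain_of_comm_left (k := k) hd hj hi H hcj
    have hX := fun (k : ℕ) => chain_of_comm_right (k := k) hd hj hi H
    obtain ⟨n, rfl⟩ : ∃ n, m = n + 1 := ⟨m - 1, by omega⟩
    obtain ⟨t1, t2, t3⟩ := chain_of_comm_right_top hd hj hi H hcj hm'.symm
    rw [← hm'] at hX hY
    refine ⟨n + 1, by omega, t3.symm, fun k hk => ?_, ?_,
      Or.inr (Or.inr (Or.inl ⟨rfl, fun k hk => ?_, ?_⟩))⟩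
    · by_cases h : k = n
      · rwa [h]
      · exact ((hX k (by omega)).2 (by omega)).1
    · rintro (_ | k) hk
      exacts [hdj, ((hY k (by omega)).2 (by omega)).1]
    · by_cases h : k = n
      · rw [h]; exact iff_of_true t2 rfl
      · exact iff_of_false ((hX k (by omega)).2 (by omega)).2 (by omega)
    · rintro (_ | k) hk
      · exact iff_of_true hcj rfl
      · exact iff_of_false ((hY k (by omega)).2 (by omega)).2 (by omega)
  · have H : ∀ a ∈ cs.parabolic J, ∀ b ∈ cs.parabolic J, a * d.1 = d.1 * θ.toMulEquiv b → a = 1 := by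
      intro a ha b hb e
      by_contra ha1
      rcases hL a ha b hb e ha1 with h | h | h <;> tauto
    have hX := fun (k : ℕ) => chain_of_free (k := k) hd hi hj H
    have hY := fun (k : ℕ) => chain_of_free (k := k) hd hj hi H
    rw [← hm] at hX
    rw [← hm'] at hY
    refine ⟨m, by omega, ?_, fun k hk => ((hX k hk.le).2 hk).1, fun k hk => ((hY k hk.le).2 hk).1,
      Or.inl ⟨Or.inl rfl, fun k hk => ((hX k hk.le).2 hk).2, fun k hk => ((hY k hk.le).2 hk).2⟩⟩
    apply Subtype.ext
    rw [(hX m le_rfl).1, (hY m le_rfl).1, hm, altMul_orderOf]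

end CoxeterInvolution

attribute [local instance] Semiring.toNatAlgebra Ring.toIntAlgebra

theorem uVar_ne_zero : (uVar : RatFunc ℚ) ≠ 0 := RatFunc.X_ne_zero

theorem uVar_add_one_ne_zero : (uVar + 1 : RatFunc ℚ) ≠ 0 := by
  have h : (algebraMap (Polynomial ℚ) (RatFunc ℚ)) (Polynomial.X + Polynomial.C 1) ≠ 0 := by
    rw [Ne, FaithfulSMul.algebraMap_eq_zero_iff]
    exact Polynomial.X_add_C_ne_zero 1
  simpa [uVar] using h

namespace CoxeterInvolution

open CoxeterSystem

variable {B : Type u} {W : Type v} [Group W] {M : CoxeterMatrix B} {cs : CoxeterSystem M W}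
  (θ : CoxeterInvolution cs)

/-! ## The Hecke operators on `M_u` -/

open Classical in
/-- The operator `T_s` on `M_u`. -/
noncomputable def heckeOp (i : B) : Module.End (RatFunc ℚ) θ.Mu :=
  Finsupp.linearCombination (RatFunc ℚ) fun z =>
    if θ.Comm i z.1 then
      if θ.Up i z then uVar • θ.a z + (uVar + 1) • θ.a (θ.ltimes i z)
      else (uVar ^ 2 - uVar - 1) • θ.a z + (uVar ^ 2 - uVar) • θ.a (θ.ltimes i z)
    else
      if θ.Up i z then θ.a (θ.ltimes i z)
      else (uVar ^ 2 - 1) • θ.a z + uVar ^ 2 • θ.a (θ.ltimes i z)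

variable {θ} {i j : B} {z d : θ.TwistedInv}

theorem heckeOp_comm_up (hc : θ.Comm i z.1) (hu : θ.Up i z) :
    θ.heckeOp i (θ.a z) = uVar • θ.a z + (uVar + 1) • θ.a (θ.ltimes i z) := by
  rw [heckeOp, a, Finsupp.linearCombination_single, one_smul, if_pos hc, if_pos hu]; rfl

theorem heckeOp_comm_down (hc : θ.Comm i z.1) (hu : ¬ θ.Up i z) :
    θ.heckeOp i (θ.a z) =
      (uVar ^ 2 - uVar - 1) • θ.a z + (uVar ^ 2 - uVar) • θ.a (θ.ltimes i z) := by
  rw [heckeOp, a, Finsupp.linearCombination_single, one_smul, if_pos hc, if_neg hu]; rfl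

theorem heckeOp_not_comm_up (hc : ¬ θ.Comm i z.1) (hu : θ.Up i z) :
    θ.heckeOp i (θ.a z) = θ.a (θ.ltimes i z) := by
  rw [heckeOp, a, Finsupp.linearCombination_single, one_smul, if_neg hc, if_pos hu]

theorem heckeOp_not_comm_down (hc : ¬ θ.Comm i z.1) (hu : ¬ θ.Up i z) :
    θ.heckeOp i (θ.a z) = (uVar ^ 2 - 1) • θ.a z + uVar ^ 2 • θ.a (θ.ltimes i z) := by
  rw [heckeOp, a, Finsupp.linearCombination_single, one_smul, if_neg hc, if_neg hu]; rfl

theorem end_ext {f g : Module.End (RatFunc ℚ) θ.Mu} (h : ∀ z, f (θ.a z) = g (θ.a z)) : f = g :=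
  Finsupp.lhom_ext' fun z => LinearMap.ext_ring (h z)

theorem heckeOp_mul_self (i : B) : θ.heckeOp i * θ.heckeOp i =
    ((uVar : RatFunc ℚ) ^ 2 - 1) • θ.heckeOp i + ((uVar : RatFunc ℚ) ^ 2) • 1 := by
  apply end_ext
  intro z
  simp only [Module.End.mul_apply, LinearMap.add_apply, LinearMap.smul_apply, Module.End.one_apply]
  by_cases hc : θ.Comm i z.1 <;> by_cases hu : θ.Up i z
  · rw [heckeOp_comm_up hc hu, map_add, map_smul, map_smul, heckeOp_comm_up hc hu,
      heckeOp_comm_down (comm_ltimes_iff.2 hc) (up_ltimes_iff.not.2 (not_not.2 hu)), ltimes_ltimes]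
    module
  · rw [heckeOp_comm_down hc hu, map_add, map_smul, map_smul, heckeOp_comm_down hc hu,
      heckeOp_comm_up (comm_ltimes_iff.2 hc) (up_ltimes_iff.2 hu), ltimes_ltimes]
    module
  · rw [heckeOp_not_comm_up hc hu,
      heckeOp_not_comm_down (comm_ltimes_iff.not.2 hc) (up_ltimes_iff.not.2 (not_not.2 hu)),
      ltimes_ltimes]
  · rw [heckeOp_not_comm_down hc hu, map_add, map_smul, map_smul, heckeOp_not_comm_down hc hu,
      heckeOp_not_comm_up (comm_ltimes_iff.not.2 hc) (up_ltimes_iff.2 hu), ltimes_ltimes]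

/-- Settles the braid relation when `s_i s_j` has order one. -/
theorem heckeOp_congr (h : cs.simple i = cs.simple j) : θ.heckeOp i = θ.heckeOp j := by
  apply end_ext
  intro z
  have h1 : θ.Comm i z.1 ↔ θ.Comm j z.1 := by rw [Comm, Comm, h]
  have h2 : θ.Up i z ↔ θ.Up j z := by rw [Up, Up, h]
  by_cases hc : θ.Comm i z.1 <;> by_cases hu : θ.Up i z
  · rw [heckeOp_comm_up hc hu, heckeOp_comm_up (h1.1 hc) (h2.1 hu), ltimes_congr h]
  · rw [heckeOp_comm_down hc hu, heckeOp_comm_down (h1.1 hc) (h2.not.1 hu), ltimes_congr h]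
  · rw [heckeOp_not_comm_up hc hu, heckeOp_not_comm_up (h1.not.1 hc) (h2.1 hu), ltimes_congr h]
  · rw [heckeOp_not_comm_down hc hu, heckeOp_not_comm_down (h1.not.1 hc) (h2.not.1 hu),
      ltimes_congr h]

/-! ### The braid relations -/

theorem altMul_heckeOp_apply_of_not_comm {n : ℕ}
    (hup : ∀ k < n, θ.Up (altLetter i j k) (θ.chain i j d k))
    (hc : ∀ k < n, ¬ θ.Comm (altLetter i j k) (θ.chain i j d k).1) :
    altMul (θ.heckeOp i) (θ.heckeOp j) n (θ.a d) = θ.a (θ.chain i j d n) := by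
  induction n with
  | zero => rfl
  | succ n ih =>
    rw [altMul_succ, Module.End.mul_apply, ih (fun k hk => hup k (by omega))
      (fun k hk => hc k (by omega)), ← apply_altLetter _ _ θ.heckeOp,
      heckeOp_not_comm_up (hc n (by omega)) (hup n (by omega)), chain_succ]

/-- Only the first step branches, into `u a_d` and `u + 1` times the next vector. The other `n`
operators turn the first term into the opposite alternating product and push the second up the
chain. -/
theorem altMul_heckeOp_apply_of_comm {n : ℕ}
    (hup : ∀ k < n + 1, θ.Up (altLetter i j k) (θ.chain i j d k)) (hc0 : θ.Comm i d.1)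
    (hc : ∀ k < n + 1, k ≠ 0 → ¬ θ.Comm (altLetter i j k) (θ.chain i j d k).1) :
    altMul (θ.heckeOp i) (θ.heckeOp j) (n + 1) (θ.a d) =
      (uVar : RatFunc ℚ) • altMul (θ.heckeOp j) (θ.heckeOp i) n (θ.a d) +
        (uVar + 1 : RatFunc ℚ) • θ.a (θ.chain i j d (n + 1)) := by
  induction n with
  | zero =>
    rw [zero_add, altMul_one, heckeOp_comm_up hc0 (hup 0 (by omega))]
    rfl
  | succ n ih =>
    rw [altMul_succ, Module.End.mul_apply, ih (fun k hk => hup k (by omega))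
      (fun k hk => hc k (by omega)), map_add, map_smul, map_smul, altLetter_succ,
      ← Module.End.mul_apply, ← altMul_succ, ← altLetter_succ, ← apply_altLetter _ _ θ.heckeOp,
      heckeOp_not_comm_up (hc (n + 1) (by omega) (by omega)) (hup (n + 1) (by omega)),
      chain_succ i j d (n + 1)]

/-- The commuting step opens one chain and closes the other. Both sides equal `u` times the vector
below the top on the `j`-chain plus `u + 1` times the top. -/
theorem altMul_heckeOp_apply_of_comm_left {n : ℕ}
    (htop : θ.chain i j d (n + 1) = θ.chain j i d (n + 1))
    (hupX : ∀ k < n + 1, θ.Up (altLetter i j k) (θ.chain i j d k))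
    (hupY : ∀ k < n + 1, θ.Up (altLetter j i k) (θ.chain j i d k))
    (hcX : ∀ k < n + 1, θ.Comm (altLetter i j k) (θ.chain i j d k).1 ↔ k = 0)
    (hcY : ∀ k < n + 1, θ.Comm (altLetter j i k) (θ.chain j i d k).1 ↔ k + 1 = n + 1) :
    altMul (θ.heckeOp i) (θ.heckeOp j) (n + 1) (θ.a d) =
      altMul (θ.heckeOp j) (θ.heckeOp i) (n + 1) (θ.a d) := by
  have hY : altMul (θ.heckeOp j) (θ.heckeOp i) n (θ.a d) = θ.a (θ.chain j i d n) :=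
    altMul_heckeOp_apply_of_not_comm (fun k hk => hupY k (by omega))
      (fun k hk => by rw [hcY k (by omega)]; omega)
  rw [altMul_heckeOp_apply_of_comm hupX ((hcX 0 (by omega)).2 rfl)
    (fun k hk hk0 => by rw [hcX k (by omega)]; omega), altMul_succ, Module.End.mul_apply, hY,
    ← apply_altLetter _ _ θ.heckeOp,
    heckeOp_comm_up ((hcY n (by omega)).2 rfl) (hupY n (by omega)), htop, chain_succ]

theorem braid_apply_of_up (hdi : θ.Up i d) (hdj : θ.Up j d) {m : ℕ}
    (hm : m = orderOf (cs.simple i * cs.simple j)) (h1 : 1 < m) :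
    altMul (θ.heckeOp i) (θ.heckeOp j) m (θ.a d) =
      altMul (θ.heckeOp j) (θ.heckeOp i) m (θ.a d) := by
  set D : ℕ → θ.Mu := fun k => altMul (θ.heckeOp i) (θ.heckeOp j) k (θ.a d) -
    altMul (θ.heckeOp j) (θ.heckeOp i) k (θ.a d) with hD
  have hrec := fun k => add_apply_altMul_sub (heckeOp_mul_self i) (heckeOp_mul_self j) k (θ.a d)
  have hD0 : D 0 = 0 := sub_self _
  have hu := uVar_ne_zero
  have refl := fun (a b : ℕ) (c : RatFunc ℚ) =>
    eq_zero_of_reflection (D := D) (a := a) (b := b) (c := c) hD0 hrec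
  obtain ⟨p, hp, htop, hupX, hupY, h | h | h | h | h | h⟩ := exists_orbit_top hdi hdj hm h1 <;>
    obtain ⟨hmp, hcX, hcY⟩ := h
  · have hDp : D p = 0 := by
      rw [hD]
      simp only [altMul_heckeOp_apply_of_not_comm hupX hcX, altMul_heckeOp_apply_of_not_comm hupY hcY,
        htop, sub_self]
    rw [← sub_eq_zero]
    rcases hmp with rfl | rfl
    · exact hDp
    · obtain ⟨n, rfl⟩ : ∃ n, p = n + 1 := ⟨p - 1, by omega⟩
      -- The middle term `D (n + 1)` vanishes, so the recursion gives `D (n + 2) = -u² D n`; hence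
      -- the constant `-1`.
      have := refl (n + 1) n (-1) (by rw [hDp, smul_zero]) ?_
      · rwa [show 2 * (n + 1) = n + 1 + n + 1 by ring]
      · have h2 : (θ.heckeOp i + θ.heckeOp j - ((uVar : RatFunc ℚ) ^ 2 - 1) • 1 :
            Module.End (RatFunc ℚ) θ.Mu) (D (n + 1)) =
          D (n + 2) + (uVar : RatFunc ℚ) ^ 2 • D n := hrec n
        rw [hDp, map_zero] at h2
        rw [show n + 1 + 1 = n + 2 from rfl, eq_neg_of_add_eq_zero_left h2.symm]
        module
  · subst hmp
    obtain ⟨n, rfl⟩ : ∃ n, m = n + 1 := ⟨m - 1, by omega⟩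
    exact altMul_heckeOp_apply_of_comm_left htop hupX hupY hcX hcY
  · subst hmp
    obtain ⟨n, rfl⟩ : ∃ n, m = n + 1 := ⟨m - 1, by omega⟩
    exact (altMul_heckeOp_apply_of_comm_left htop.symm hupY hupX hcY hcX).symm
  · obtain ⟨n, rfl⟩ : ∃ n, p = n + 1 := ⟨p - 1, by omega⟩
    have e1 := altMul_heckeOp_apply_of_comm (n := n) hupX ((hcX 0 (by omega)).2 rfl)
      (fun k hk hk0 => by rw [hcX k (by omega)]; omega)
    have e2 := altMul_heckeOp_apply_of_comm (n := n) hupY ((hcY 0 (by omega)).2 rfl)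
      (fun k hk hk0 => by rw [hcY k (by omega)]; omega)
    -- The common top cancels. The sign appears because a commuting first step exchanges the two
    -- alternating products.
    have e3 : D (n + 1) = (-uVar : RatFunc ℚ) • D n := by
      simp only [hD, e1, e2, htop]; module
    have := refl (n) n (-uVar⁻¹)
      (by rw [e3, smul_smul, neg_mul_neg, inv_mul_cancel₀ hu, one_smul])
      (by rw [e3]; congr 1; field_simp)
    rw [show m = n + n + 1 by omega, ← sub_eq_zero]
    exact this
  · obtain ⟨n, rfl⟩ : ∃ n, p = n + 1 + 1 := ⟨p - 2, by omega⟩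
    have step : ∀ {i j : B}, (∀ k < n + 1 + 1, θ.Up (altLetter i j k) (θ.chain i j d k)) →
        (∀ k < n + 1 + 1, θ.Comm (altLetter i j k) (θ.chain i j d k).1 ↔ k = 0 ∨ k + 1 = n + 1 + 1) →
        altMul (θ.heckeOp i) (θ.heckeOp j) (n + 1) (θ.a d) =
          (uVar : RatFunc ℚ) • altMul (θ.heckeOp j) (θ.heckeOp i) n (θ.a d) +
            (uVar + 1 : RatFunc ℚ) • θ.a (θ.chain i j d (n + 1)) ∧
        altMul (θ.heckeOp i) (θ.heckeOp j) (n + 2) (θ.a d) =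
          (uVar : RatFunc ℚ) • altMul (θ.heckeOp j) (θ.heckeOp i) (n + 1) (θ.a d) +
            (uVar + 1 : RatFunc ℚ) • ((uVar : RatFunc ℚ) • θ.a (θ.chain i j d (n + 1)) +
              (uVar + 1 : RatFunc ℚ) • θ.a (θ.chain i j d (n + 1 + 1))) := by
      intro i j hup hc
      have e1 := altMul_heckeOp_apply_of_comm (n := n) (fun k hk => hup k (by omega))
        ((hc 0 (by omega)).2 (Or.inl rfl)) (fun k hk hk0 => by rw [hc k (by omega)]; omega)
      refine ⟨e1, ?_⟩
      rw [show n + 2 = n + 1 + 1 from rfl, altMul_succ, Module.End.mul_apply, e1, map_add, map_smul,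
        map_smul, altLetter_succ, ← Module.End.mul_apply, ← altMul_succ, ← altLetter_succ,
        ← apply_altLetter _ _ θ.heckeOp,
        heckeOp_comm_up ((hc (n + 1) (by omega)).2 (Or.inr rfl)) (hup (n + 1) (by omega)),
        chain_succ i j d (n + 1)]
    obtain ⟨e1, e2⟩ := step hupX hcX
    obtain ⟨f1, f2⟩ := step hupY hcY
    -- Eliminating the difference of the two vectors just below the top from `D (n + 1)` and `D (n +
    -- 2)` leaves `D (n + 2) = u² D n`.
    have := refl (n + 1) n (1) (one_smul _ _).symm (by
      simp only [hD, show n + 1 + 1 = n + 2 from rfl, e2, f2, htop]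
      rw [e1, f1]
      module)
    rw [show m = n + 1 + n + 1 by omega, ← sub_eq_zero]
    exact this
  · obtain ⟨n, rfl⟩ : ∃ n, p = n + 1 := ⟨p - 1, by omega⟩
    have step : ∀ {i j : B}, (∀ k < n + 1, θ.Up (altLetter i j k) (θ.chain i j d k)) →
        (∀ k < n + 1, θ.Comm (altLetter i j k) (θ.chain i j d k).1 ↔ k + 1 = n + 1) →
        altMul (θ.heckeOp i) (θ.heckeOp j) (n + 1) (θ.a d) =
          (uVar : RatFunc ℚ) • altMul (θ.heckeOp i) (θ.heckeOp j) n (θ.a d) +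
            (uVar + 1 : RatFunc ℚ) • θ.a (θ.chain i j d (n + 1)) := by
      intro i j hup hc
      rw [altMul_succ, Module.End.mul_apply, altMul_heckeOp_apply_of_not_comm
        (fun k hk => hup k (by omega)) (fun k hk => by rw [hc k (by omega)]; omega),
        ← apply_altLetter _ _ θ.heckeOp,
        heckeOp_comm_up ((hc n (by omega)).2 rfl) (hup n (by omega)), chain_succ]
    have e3 : D (n + 1) = (uVar : RatFunc ℚ) • D n := by
      simp only [hD, step hupX hcX, step hupY hcY, htop]; module
    have := refl (n) n (uVar⁻¹)
      (by rw [e3, smul_smul, inv_mul_cancel₀ hu, one_smul])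
      (by rw [e3]; congr 1; field_simp)
    rw [show m = n + n + 1 by omega, ← sub_eq_zero]
    exact this

theorem heckeOp_braid (i j : B) (h0 : 0 < orderOf (cs.simple i * cs.simple j)) :
    altMul (θ.heckeOp i) (θ.heckeOp j) (orderOf (cs.simple i * cs.simple j)) =
      altMul (θ.heckeOp j) (θ.heckeOp i) (orderOf (cs.simple i * cs.simple j)) := by
  rcases Nat.lt_or_ge 1 (orderOf (cs.simple i * cs.simple j)) with h1 | h1
  swap
  · have h2 : orderOf (cs.simple i * cs.simple j) = 1 := by omega
    have h3 : cs.simple i = cs.simple j := by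
      rw [orderOf_eq_one_iff] at h2
      rw [eq_inv_of_mul_eq_one_left h2, cs.inv_simple]
    rw [heckeOp_congr h3]
  apply end_ext
  intro z
  induction hn : cs.length z.1 using Nat.strong_induction_on generalizing z with
  | _ n ih =>
  subst hn
  -- descend along a simple reflection, using that the kernel of the difference is stable
  have cancel : ∀ k, ¬ θ.Up k z →
      (∀ v, altMul (θ.heckeOp i) (θ.heckeOp j) (orderOf (cs.simple i * cs.simple j)) v =
        altMul (θ.heckeOp j) (θ.heckeOp i) (orderOf (cs.simple i * cs.simple j)) v →
        altMul (θ.heckeOp i) (θ.heckeOp j) (orderOf (cs.simple i * cs.simple j)) (θ.heckeOp k v) =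
        altMul (θ.heckeOp j) (θ.heckeOp i) (orderOf (cs.simple i * cs.simple j)) (θ.heckeOp k v)) →
      altMul (θ.heckeOp i) (θ.heckeOp j) (orderOf (cs.simple i * cs.simple j)) (θ.a z) =
        altMul (θ.heckeOp j) (θ.heckeOp i) (orderOf (cs.simple i * cs.simple j)) (θ.a z) := by
    intro k hk hstab
    have hy := ih _ (length_ltimes_lt hk) (θ.ltimes k z) rfl
    have hyk := hstab _ hy
    by_cases hc : θ.Comm k z.1
    · rw [heckeOp_comm_up (comm_ltimes_iff.2 hc) (up_ltimes_iff.2 hk), ltimes_ltimes, map_add,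
        map_add, map_smul, map_smul, map_smul, map_smul, hy, add_right_inj] at hyk
      exact smul_right_injective _ uVar_add_one_ne_zero hyk
    · rwa [heckeOp_not_comm_up (comm_ltimes_iff.not.2 hc) (up_ltimes_iff.2 hk), ltimes_ltimes] at hyk
  by_cases hi : θ.Up i z
  · by_cases hj : θ.Up j z
    · exact braid_apply_of_up hi hj rfl h1
    · exact cancel j hj fun v hv =>
        altMul_sub_apply_eq_zero (heckeOp_mul_self i) (heckeOp_mul_self j) _ hv
  · exact cancel i hi fun v hv =>
      (altMul_sub_apply_eq_zero (heckeOp_mul_self j) (heckeOp_mul_self i) _ hv.symm).symm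

/-! ### The representation of the Hecke algebra -/

variable (θ) in
/-- The operator `T_x` on `M_u`. -/
noncomputable def heckeT (x : W) : Module.End (RatFunc ℚ) θ.Mu :=
  ((cs.exists_isReduced x).choose.map θ.heckeOp).prod

theorem heckeT_wordProd {ω : List B} (hω : cs.IsReduced ω) :
    θ.heckeT (cs.wordProd ω) = (ω.map θ.heckeOp).prod :=
  have h := (cs.exists_isReduced (cs.wordProd ω)).choose_spec
  prod_map_eq_of_isReduced θ.heckeOp heckeOp_braid h.1 hω h.2.symm

theorem heckeT_simple (i : B) : θ.heckeT (cs.simple i) = θ.heckeOp i := by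
  have h : cs.IsReduced [i] := by simp [CoxeterSystem.IsReduced]
  simpa using heckeT_wordProd (θ := θ) h

theorem heckeT_mul {x y : W} (h : cs.length (x * y) = cs.length x + cs.length y) :
    θ.heckeT x * θ.heckeT y = θ.heckeT (x * y) := by
  obtain ⟨ω, hω, rfl⟩ := cs.exists_isReduced x
  obtain ⟨η, hη, rfl⟩ := cs.exists_isReduced y
  have hr : cs.IsReduced (ω ++ η) := by
    rw [CoxeterSystem.IsReduced, cs.wordProd_append, h, hω.eq, hη.eq, List.length_append]
  rw [← cs.wordProd_append, heckeT_wordProd hω, heckeT_wordProd hη, heckeT_wordProd hr,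
    List.map_append, List.prod_append]

theorem lift_heckeT_rel {x y : FreeAlgebra (RatFunc ℚ) W} (h : HeckeRel cs (uVar ^ 2) x y) :
    FreeAlgebra.lift (RatFunc ℚ) θ.heckeT x = FreeAlgebra.lift (RatFunc ℚ) θ.heckeT y := by
  cases h with
  | one =>
    have h : cs.IsReduced ([] : List B) := by simp [CoxeterSystem.IsReduced]
    simpa using heckeT_wordProd (θ := θ) h
  | mul x y h => simp [heckeT_mul h]
  | quad i =>
    have := heckeOp_mul_self (θ := θ) i
    simp only [map_mul, map_add, map_sub, FreeAlgebra.lift_ι_apply, heckeT_simple, map_one,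
      map_zero, Algebra.algebraMap_eq_smul_one, map_smul]
    refine LinearMap.ext fun v => ?_
    have hv := LinearMap.congr_fun this v
    simp only [Module.End.mul_apply, LinearMap.add_apply, LinearMap.sub_apply, LinearMap.smul_apply,
      Module.End.one_apply, map_sub, map_smul, LinearMap.zero_apply] at hv ⊢
    rw [hv]
    module

variable (θ) in
/-- The representation of the Hecke algebra on `M_u`. -/
noncomputable def heckeRep :
    HeckeAlgebra cs ((uVar : RatFunc ℚ) ^ 2) →ₐ[RatFunc ℚ] Module.End (RatFunc ℚ) θ.Mu :=
  RingQuot.liftAlgHom (RatFunc ℚ) ⟨FreeAlgebra.lift (RatFunc ℚ) θ.heckeT,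
    fun _ _ h => lift_heckeT_rel h⟩

theorem heckeRep_T (x : W) : θ.heckeRep (HeckeAlgebra.T cs (uVar ^ 2) x) = θ.heckeT x := by
  rw [heckeRep, HeckeAlgebra.T, RingQuot.liftAlgHom_mkAlgHom_apply, FreeAlgebra.lift_ι_apply]

theorem heckeRep_isInvolutionModule : θ.IsInvolutionModule θ.heckeRep where
  comm_up i x hc hl := by
    rw [heckeRep_T, heckeT_simple, heckeOp_comm_up hc (up_iff.2 hl)]
  comm_down i x hc hl := by
    rw [heckeRep_T, heckeT_simple, heckeOp_comm_down hc (not_up_iff.2 hl)]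
  not_comm_up i x hc hl := by
    rw [heckeRep_T, heckeT_simple, heckeOp_not_comm_up hc (up_iff.2 hl)]
  not_comm_down i x hc hl := by
    rw [heckeRep_T, heckeT_simple, heckeOp_not_comm_down hc (not_up_iff.2 hl)]

theorem IsInvolutionModule.map_simple
    {ρ : HeckeAlgebra cs ((uVar : RatFunc ℚ) ^ 2) →ₐ[RatFunc ℚ] Module.End (RatFunc ℚ) θ.Mu}
    (hρ : θ.IsInvolutionModule ρ) (i : B) :
    ρ (HeckeAlgebra.T cs (uVar ^ 2) (cs.simple i)) = θ.heckeOp i := by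
  apply end_ext
  intro z
  by_cases hc : θ.Comm i z.1 <;> by_cases hu : θ.Up i z
  · rw [heckeOp_comm_up hc hu, hρ.comm_up i z hc (up_iff.1 hu)]
  · rw [heckeOp_comm_down hc hu, hρ.comm_down i z hc (not_up_iff.1 hu)]
  · rw [heckeOp_not_comm_up hc hu, hρ.not_comm_up i z hc (up_iff.1 hu)]
  · rw [heckeOp_not_comm_down hc hu, hρ.not_comm_down i z hc (not_up_iff.1 hu)]

theorem HeckeAlgebra_T_wordProd {R : Type*} [CommRing R] {q : R} {ω : List B}
    (hω : cs.IsReduced ω) : HeckeAlgebra.T cs q (cs.wordProd ω) =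
      (ω.map fun i => HeckeAlgebra.T cs q (cs.simple i)).prod := by
  induction ω with
  | nil => rw [HeckeAlgebra.T, cs.wordProd_nil, RingQuot.mkAlgHom_rel _ (HeckeRel.one), map_one]; rfl
  | cons i ω ih =>
    have h : cs.length (cs.simple i * cs.wordProd ω) =
        cs.length (cs.simple i) + cs.length (cs.wordProd ω) := by
      rw [← cs.wordProd_cons, hω.eq, hω.tail.eq, cs.length_simple, List.length_cons, add_comm]
    have := RingQuot.mkAlgHom_rel R (HeckeRel.mul (cs := cs) (q := q) _ _ h)
    rw [map_mul] at this
    rw [List.map_cons, List.prod_cons, ← ih hω.tail, cs.wordProd_cons]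
    exact this.symm

theorem IsInvolutionModule.map_wordProd
    {ρ : HeckeAlgebra cs ((uVar : RatFunc ℚ) ^ 2) →ₐ[RatFunc ℚ] Module.End (RatFunc ℚ) θ.Mu}
    (hρ : θ.IsInvolutionModule ρ) {ω : List B} (hω : cs.IsReduced ω) :
    ρ (HeckeAlgebra.T cs (uVar ^ 2) (cs.wordProd ω)) = (ω.map θ.heckeOp).prod := by
  rw [HeckeAlgebra_T_wordProd hω, map_list_prod, List.map_map]
  congr 2
  funext i
  exact hρ.map_simple i

theorem IsInvolutionModule.eq
    {ρ ρ' : HeckeAlgebra cs ((uVar : RatFunc ℚ) ^ 2) →ₐ[RatFunc ℚ] Module.End (RatFunc ℚ) θ.Mu}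
    (hρ : θ.IsInvolutionModule ρ) (hρ' : θ.IsInvolutionModule ρ') : ρ = ρ' := by
  apply RingQuot.ringQuot_ext'
  apply FreeAlgebra.hom_ext
  funext x
  obtain ⟨ω, hω, rfl⟩ := cs.exists_isReduced x
  exact (hρ.map_wordProd hω).trans (hρ'.map_wordProd hω).symm

end CoxeterInvolution

namespace CoxeterInvolution

open CoxeterSystem

variable {B : Type u} {W : Type v} [Group W] {M : CoxeterMatrix B} {cs : CoxeterSystem M W}
  {θ : CoxeterInvolution cs}

/-! ## The rank function -/

theorem exists_not_up {z : θ.TwistedInv} (h : z ≠ θ.one) : ∃ i, ¬ θ.Up i z := by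
  obtain ⟨i, hi⟩ := cs.exists_leftDescent_of_ne_one (w := z.1) (fun h' => h (Subtype.ext h'))
  exact ⟨i, not_up_iff.2 hi⟩

theorem up_one (i : B) : θ.Up i θ.one := by
  rw [up_iff]; simp [one]

open Classical in
variable (θ) in
/-- The number of steps of a descending path from `z` to `1`. -/
noncomputable def rank (z : θ.TwistedInv) : ℕ :=
  if h : z = θ.one then 0 else rank (θ.ltimes (exists_not_up h).choose z) + 1
termination_by cs.length z.1
decreasing_by exact length_ltimes_lt (exists_not_up h).choose_spec

theorem rank_one : θ.rank θ.one = 0 := by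
  rw [rank, dif_pos rfl]

/-- Every twisted involution lies on an increasing rank two chain. -/
theorem exists_chain (i j : B) (z : θ.TwistedInv) :
    ∃ d, θ.Up i d ∧ θ.Up j d ∧ ∃ k,
      (θ.chain i j d k = z ∧ ∀ l < k, θ.Up (altLetter i j l) (θ.chain i j d l)) ∨
      (θ.chain j i d k = z ∧ ∀ l < k, θ.Up (altLetter j i l) (θ.chain j i d l)) := by
  induction hn : cs.length z.1 using Nat.strong_induction_on generalizing z with
  | _ n ih =>
  subst hn
  have extend : ∀ {a b c : B} {d : θ.TwistedInv} {k : ℕ}, (c = a ∨ c = b) → ¬ θ.Up c z →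
      θ.chain a b d k = θ.ltimes c z → (∀ l < k, θ.Up (altLetter a b l) (θ.chain a b d l)) →
      (k = 0 → c = a) →
      θ.chain a b d (k + 1) = z ∧ ∀ l < k + 1, θ.Up (altLetter a b l) (θ.chain a b d l) := by
    intro a b c d k hc hcz hk hl h0
    have hcu := up_ltimes_iff.2 hcz
    -- The letter just used is a descent at the end of the chain, whereas `c` goes up there; so `c`
    -- is the next letter.
    have hlet : altLetter a b k = c := by
      cases k with
      | zero => exact (h0 rfl).symm
      | succ k =>
        have h1 := (hl k (by omega)).not_up_ltimes
        rw [← chain_succ, hk] at h1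
        have h2 : altLetter a b k ≠ c := by rintro h; rw [h] at h1; exact h1 hcu
        rw [altLetter_succ]
        rcases altLetter_cases a b k with h | h <;> rw [h.1] at h2 <;> rw [h.2] <;>
          rcases hc with rfl | rfl <;> tauto
    refine ⟨by rw [chain_succ, hk, hlet, ltimes_ltimes], fun l hlk => ?_⟩
    by_cases h : l = k
    · rw [h, hlet, hk]; exact hcu
    · exact hl l (by omega)
  have step : ∀ c, (c = i ∨ c = j) → ¬ θ.Up c z → ∃ d, θ.Up i d ∧ θ.Up j d ∧ ∃ k,
      (θ.chain i j d k = z ∧ ∀ l < k, θ.Up (altLetter i j l) (θ.chain i j d l)) ∨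
      (θ.chain j i d k = z ∧ ∀ l < k, θ.Up (altLetter j i l) (θ.chain j i d l)) := by
    intro c hc hcz
    obtain ⟨d, hi, hj, k, h⟩ := ih _ (length_ltimes_lt hcz) _ rfl
    refine ⟨d, hi, hj, k + 1, ?_⟩
    by_cases hk : k = 0
    · subst hk
      have h0 : θ.chain i j d 0 = θ.ltimes c z := by rcases h with h | h <;> exact h.1
      rcases hc with rfl | rfl
      · exact Or.inl (extend (Or.inl rfl) hcz h0 (by simp) (fun _ => rfl))
      · exact Or.inr (extend (Or.inl rfl) hcz h0 (by simp) (fun _ => rfl))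
    · rcases h with h | h
      · exact Or.inl (extend hc hcz h.1 h.2 (fun h => absurd h hk))
      · exact Or.inr (extend hc.symm hcz h.1 h.2 (fun h => absurd h hk))
  by_cases hi : θ.Up i z
  · by_cases hj : θ.Up j z
    · exact ⟨z, hi, hj, 0, Or.inl ⟨rfl, by simp⟩⟩
    · exact step j (Or.inr rfl) hj
  · exact step i (Or.inl rfl) hi

/-- A twisted involution with left descents `i` and `j` is the common end of two increasing chains
of the same length. -/
theorem exists_chain_eq {i j : B} {z : θ.TwistedInv} (hij : cs.simple i ≠ cs.simple j)
    (hi : ¬ θ.Up i z) (hj : ¬ θ.Up j z) :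
    ∃ d p, θ.chain i j d (p + 1) = z ∧ θ.chain j i d (p + 1) = z ∧
      (∀ k < p + 1, θ.Up (altLetter i j k) (θ.chain i j d k)) ∧
      (∀ k < p + 1, θ.Up (altLetter j i k) (θ.chain j i d k)) := by
  have h0 := orderOf_pos_of_descents (not_not.1 hi) (not_not.1 hj)
  have h1 : 1 < orderOf (cs.simple i * cs.simple j) := by
    rcases Nat.lt_or_ge 1 (orderOf (cs.simple i * cs.simple j)) with h | h
    · exact h
    · exfalso
      have h2 : orderOf (cs.simple i * cs.simple j) = 1 := by omega
      rw [orderOf_eq_one_iff] at h2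
      exact hij (by rw [eq_inv_of_mul_eq_one_left h2, cs.inv_simple])
  obtain ⟨d, hdi, hdj, k, hk⟩ := exists_chain i j z
  obtain ⟨p, hp, htop, hX, hY, -⟩ := exists_orbit_top hdi hdj rfl h1
  obtain ⟨p, rfl⟩ : ∃ q, p = q + 1 := ⟨p - 1, by omega⟩
  refine ⟨d, p, ?_⟩
  -- the top of the orbit has both descents
  have htX := (hX p (by omega)).not_up_ltimes
  have htY := (hY p (by omega)).not_up_ltimes
  rw [← chain_succ] at htX htY
  have both : ∀ l, ¬ θ.Up (altLetter i j l) (θ.chain i j d (p + 1)) ∧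
      ¬ θ.Up (altLetter j i l) (θ.chain j i d (p + 1)) := by
    intro l
    rw [← htop] at htY
    rw [← htop]
    rcases altLetter_cases i j l with h | h <;> rcases altLetter_cases i j p with h' | h' <;>
      rw [h'.1] at htX <;> rw [h'.2] at htY <;> rw [h.1, h.2] <;> exact ⟨by assumption, by assumption⟩
  have bothz : ∀ l, ¬ θ.Up (altLetter i j l) z ∧ ¬ θ.Up (altLetter j i l) z := by
    intro l
    rcases altLetter_cases i j l with h | h <;> rw [h.1, h.2] <;> exact ⟨by assumption, by assumption⟩
  -- A chain stopping earlier would still go up at `z`, and a longer one would go up at the top of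
  -- the orbit; both points have `i` and `j` as descents.
  have hkp : k = p + 1 := by
    rcases lt_trichotomy k (p + 1) with h | h | h
    · exfalso
      rcases hk with hk | hk
      · have := hX k h; rw [hk.1] at this; exact (bothz k).1 this
      · have := hY k h; rw [hk.1] at this; exact (bothz k).2 this
    · exact h
    · exfalso
      rcases hk with hk | hk
      · exact (both (p + 1)).1 (hk.2 _ h)
      · exact (both (p + 1)).2 (hk.2 _ h)
  subst hkp
  have hz : θ.chain i j d (p + 1) = z := by
    rcases hk with hk | hk
    · exact hk.1
    · rw [htop]; exact hk.1
  exact ⟨hz, by rw [← htop]; exact hz, hX, hY⟩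

/-- The rank does not depend on the descent chosen in its definition. If `i` and the chosen `j` give
different reflections, `z` is the top of a rank two orbit with bottom `d`; its two chains have equal
length, so by induction both predecessors of `z` have rank `rank d + p`. -/
theorem rank_of_not_up {i : B} {z : θ.TwistedInv} (hi : ¬ θ.Up i z) :
    θ.rank z = θ.rank (θ.ltimes i z) + 1 := by
  induction hn : cs.length z.1 using Nat.strong_induction_on generalizing z i with
  | _ n ih =>
  subst hn
  have hz : z ≠ θ.one := by rintro rfl; exact hi (up_one i)
  rw [rank, dif_neg hz]
  set j := (exists_not_up hz).choose with hj'
  have hj : ¬ θ.Up j z := (exists_not_up hz).choose_spec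
  by_cases hij : cs.simple i = cs.simple j
  · rw [ltimes_congr hij]
  obtain ⟨d, p, hX, hY, hupX, hupY⟩ := exists_chain_eq hij hi hj
  have hlen : ∀ {a b : B}, θ.chain a b d (p + 1) = z →
      (∀ k < p + 1, θ.Up (altLetter a b k) (θ.chain a b d k)) →
      ∀ k ≤ p, cs.length (θ.chain a b d k).1 < cs.length z.1 ∧ θ.rank (θ.chain a b d k) =
        θ.rank d + k := by
    intro a b hz hup k hk
    have hl : ∀ n, n ≤ p → cs.length (θ.chain a b d (p - n)).1 < cs.length z.1 := by
      intro n hn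
      induction n with
      | zero =>
        have := (hup p (by omega)).lt_length_ltimes
        rwa [← chain_succ, hz] at this
      | succ n ih =>
        have := (hup (p - (n + 1)) (by omega)).lt_length_ltimes
        rw [← chain_succ, show p - (n + 1) + 1 = p - n by omega] at this
        exact this.trans (ih (by omega))
    refine ⟨by simpa [Nat.sub_sub_self hk] using hl (p - k) (by omega), ?_⟩
    induction k with
    | zero => rfl
    | succ k ihk =>
      have hlk := hl (p - (k + 1)) (by omega)
      rw [Nat.sub_sub_self hk] at hlk
      have := ih _ hlk (hup k (by omega)).not_up_ltimes rfl
      rw [← chain_succ, chain_succ, ltimes_ltimes] at this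
      rw [chain_succ, this, ihk (by omega)]
      omega
  have hpX := (hlen hX hupX p le_rfl).2
  have hpY := (hlen hY hupY p le_rfl).2
  have eX : θ.ltimes (altLetter i j p) z = θ.chain i j d p := by
    rw [← hX, chain_succ, ltimes_ltimes]
  have eY : θ.ltimes (altLetter j i p) z = θ.chain j i d p := by
    rw [← hY, chain_succ, ltimes_ltimes]
  rcases altLetter_cases i j p with h | h
  · rw [h.1] at eX; rw [h.2] at eY; rw [eX, eY, hpX, hpY]
  · rw [h.1] at eX; rw [h.2] at eY; rw [eX, eY, hpX, hpY]

theorem Up.rank_ltimes {i : B} {z : θ.TwistedInv} (h : θ.Up i z) :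
    θ.rank (θ.ltimes i z) = θ.rank z + 1 := by
  rw [rank_of_not_up h.not_up_ltimes, ltimes_ltimes]

theorem rank_ltimes_le (i : B) (z : θ.TwistedInv) : θ.rank (θ.ltimes i z) ≤ θ.rank z + 1 := by
  by_cases h : θ.Up i z
  · exact h.rank_ltimes.le
  · rw [rank_of_not_up h]; omega

/-! ## Reduced expressions -/

theorem exprProd_cons (i : B) (ω : List B) :
    θ.exprProd (i :: ω) = θ.ltimes i (θ.exprProd ω) := rfl

theorem rank_exprProd_le (ω : List B) : θ.rank (θ.exprProd ω) ≤ ω.length := by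
  induction ω with
  | nil => exact rank_one.le
  | cons i ω ih =>
    rw [exprProd_cons, List.length_cons]
    exact (rank_ltimes_le _ _).trans (by omega)

theorem exists_exprProd_eq (z : θ.TwistedInv) : ∃ ω, θ.exprProd ω = z ∧ ω.length = θ.rank z := by
  induction hn : θ.rank z generalizing z with
  | zero =>
    by_cases hz : z = θ.one
    · exact ⟨[], hz.symm, rfl⟩
    · obtain ⟨i, hi⟩ := exists_not_up hz
      rw [rank_of_not_up hi] at hn
      omega
  | succ n ih =>
    have hz : z ≠ θ.one := by rintro rfl; rw [rank_one] at hn; omega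
    obtain ⟨i, hi⟩ := exists_not_up hz
    rw [rank_of_not_up hi] at hn
    obtain ⟨ω, h1, h2⟩ := ih (θ.ltimes i z) (by omega)
    exact ⟨i :: ω, by rw [exprProd_cons, h1, ltimes_ltimes], by rw [List.length_cons, h2]⟩

theorem IsReducedExpr.length_eq_rank {ω : List B} {z : θ.TwistedInv} (h : θ.IsReducedExpr ω z) :
    ω.length = θ.rank z := by
  refine le_antisymm ?_ ?_
  · obtain ⟨ω', h1, h2⟩ := exists_exprProd_eq z
    rw [← h2]
    exact h.2 ω' h1
  · rw [← h.1]
    exact rank_exprProd_le ω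

theorem rank_exprProd_tail {i : B} {ω : List B}
    (h : (i :: ω).length = θ.rank (θ.exprProd (i :: ω))) :
    ω.length = θ.rank (θ.exprProd ω) ∧ θ.Up i (θ.exprProd ω) := by
  rw [exprProd_cons, List.length_cons] at h
  have h1 := rank_exprProd_le (θ := θ) ω
  by_cases hu : θ.Up i (θ.exprProd ω)
  · rw [hu.rank_ltimes] at h
    exact ⟨by omega, hu⟩
  · have := rank_of_not_up hu
    omega

/-- A reduced `I_*`-expression is a reduced word. -/
theorem isReduced_of_length_eq_rank {ω : List B} (h : ω.length = θ.rank (θ.exprProd ω)) :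
    cs.IsReduced ω := by
  -- `v` collects the right factors of the non-commuting steps. Such a step raises the length by
  -- two, the number of letters by one and `ℓ(v)` by at most one.
  have key : ∃ v, (θ.exprProd ω).1 = cs.wordProd ω * v ∧
      ω.length + cs.length v ≤ cs.length (θ.exprProd ω).1 := by
    induction ω with
    | nil => exact ⟨1, by simp [exprProd, one], by simp⟩
    | cons i ω ih =>
      obtain ⟨h1, hu⟩ := rank_exprProd_tail h
      obtain ⟨v, hv, hl⟩ := ih h1
      rw [exprProd_cons, cs.wordProd_cons, List.length_cons]
      by_cases hc : θ.Comm i (θ.exprProd ω).1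
      · refine ⟨v, ?_, ?_⟩
        · rw [ltimes_of_comm hc, hv, mul_assoc]
        · rw [ltimes_of_comm hc, hu.length_eq]; omega
      · refine ⟨v * θ.toMulEquiv (cs.simple i), ?_, ?_⟩
        · rw [ltimes_of_not_comm hc, hv]; simp only [mul_assoc]
        · have h3 := cs.length_mul_le v (θ.toMulEquiv (cs.simple i))
          rw [θ.length_star, cs.length_simple] at h3
          rw [hu.length_of_not_comm hc]; omega
  obtain ⟨v, h1, h2⟩ := key
  have h3 := cs.length_mul_le (cs.wordProd ω) v
  rw [← h1] at h3
  exact le_antisymm (cs.length_wordProd_le ω) (by omega)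

/-! ### Triangularity of the vectors `T_σ a_1`. -/

theorem heckeOp_mem_span (i : B) {k : ℕ} {m : θ.Mu}
    (hm : m ∈ Submodule.span ringA (θ.a '' {y | θ.rank y < k})) :
    θ.heckeOp i m ∈ Submodule.span ringA (θ.a '' {y | θ.rank y < k + 1}) := by
  have hu : uVar ∈ ringA := Subring.subset_closure (by simp)
  have hsmul : ∀ {c : RatFunc ℚ}, c ∈ ringA → ∀ {y : θ.TwistedInv}, θ.rank y < k + 1 →
      c • θ.a y ∈ Submodule.span ringA (θ.a '' {y | θ.rank y < k + 1}) := fun {c} hc y hy =>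
    Submodule.smul_mem _ (⟨c, hc⟩ : ringA) (Submodule.subset_span ⟨y, hy, rfl⟩)
  induction hm using Submodule.span_induction with
  | mem y hy =>
    obtain ⟨z, hz, rfl⟩ := hy
    have hz0 : θ.rank z < k + 1 := Nat.lt_succ_of_lt hz
    have hz1 : θ.rank (θ.ltimes i z) < k + 1 := (rank_ltimes_le i z).trans_lt (Nat.succ_lt_succ hz)
    by_cases hc : θ.Comm i z.1 <;> by_cases hup : θ.Up i z
    · rw [heckeOp_comm_up hc hup]
      exact add_mem (hsmul hu hz0) (hsmul (add_mem hu (one_mem _)) hz1)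
    · rw [heckeOp_comm_down hc hup]
      exact add_mem (hsmul (sub_mem (sub_mem (pow_mem hu 2) hu) (one_mem _)) hz0)
        (hsmul (sub_mem (pow_mem hu 2) hu) hz1)
    · rw [heckeOp_not_comm_up hc hup]
      exact Submodule.subset_span ⟨_, hz1, rfl⟩
    · rw [heckeOp_not_comm_down hc hup]
      exact add_mem (hsmul (sub_mem (pow_mem hu 2) (one_mem _)) hz0) (hsmul (pow_mem hu 2) hz1)
  | zero => rw [map_zero]; exact zero_mem _
  | add y z _ _ hy hz => rw [map_add]; exact add_mem hy hz
  | smul c y _ hy =>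
    have : c • y = (c : RatFunc ℚ) • y := rfl
    rw [this, map_smul]
    exact Submodule.smul_mem _ c hy

/-- The element `T_σ a_1` is triangular with respect to the rank function. -/
theorem exists_prod_heckeOp_apply {ω : List B} (h : ω.length = θ.rank (θ.exprProd ω)) :
    ∃ n : ℕ, (ω.map θ.heckeOp).prod (θ.a θ.one) -
        ((uVar : RatFunc ℚ) + 1) ^ n • θ.a (θ.exprProd ω) ∈
      Submodule.span ringA (θ.a '' {y | θ.rank y < θ.rank (θ.exprProd ω)}) := by
  have hu : uVar ∈ ringA := Subring.subset_closure (by simp)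
  induction ω with
  | nil => exact ⟨0, by simp [exprProd]⟩
  | cons i ω ih =>
    obtain ⟨h1, hup⟩ := rank_exprProd_tail h
    obtain ⟨n, hn⟩ := ih h1
    have hF := heckeOp_mem_span i hn
    rw [map_sub, map_smul] at hF
    rw [exprProd_cons, hup.rank_ltimes, List.map_cons, List.prod_cons, Module.End.mul_apply]
    by_cases hc : θ.Comm i (θ.exprProd ω).1
    -- A commuting step multiplies the diagonal by `u + 1`; its other term, a multiple of `a` at the
    -- previous involution, has lower rank.
    · refine ⟨n + 1, ?_⟩
      rw [heckeOp_comm_up hc hup, smul_add, smul_smul, smul_smul, ← pow_succ,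
        sub_add_eq_sub_sub_swap] at hF
      have hm : ((uVar + 1) ^ n * uVar) • θ.a (θ.exprProd ω) ∈
          Submodule.span ringA (θ.a '' {y | θ.rank y < θ.rank (θ.exprProd ω) + 1}) :=
        Submodule.smul_mem _
          (⟨_, mul_mem (pow_mem (add_mem hu (one_mem _)) n) hu⟩ : ringA)
          (Submodule.subset_span ⟨_, Nat.lt_succ_self _, rfl⟩)
      simpa using add_mem hF hm
    · refine ⟨n, ?_⟩
      rwa [heckeOp_not_comm_up hc hup] at hF

end CoxeterInvolution

/-! ## Triangular families -/

section Triangular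

variable {R N ι : Type*} [CommRing R] [AddCommGroup N] [Module R N]

/-- The family `f` is triangular with diagonal `c` with respect to the basis `b`, filtered by `r`. -/
def IsTriangular (b : Module.Basis ι R N) (r : ι → ℕ) (c : ι → R) (f : ι → N) : Prop :=
  ∀ z, f z - c z • b z ∈ Submodule.span R (b '' {y | r y < r z})

variable {b : Module.Basis ι R N} {r : ι → ℕ} {c : ι → R} {f : ι → N}

theorem IsTriangular.isBasisFamily (h : IsTriangular b r c f) (hc : ∀ z, IsUnit (c z)) :
    IsBasisFamily R f := by
  constructor
  · rw [linearIndependent_iff]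
    intro l hl
    by_contra hne
    obtain ⟨z, hz, hmax⟩ := l.support.exists_max_image r (Finsupp.support_nonempty_iff.2 hne)
    -- As `z` has maximal rank in the support, every `f y` in the relation meets coordinate `z` only
    -- through its diagonal term; that coordinate is `l z * c z`.
    have hrepr : ∀ y, r y ≤ r z → b.repr (f y) z = c y * b.repr (b y) z := by
      intro y hy
      have h1 : b.repr (f y - c y • b y) z = 0 := by
        by_contra h0
        have := b.repr_support_subset_of_mem_span _ (h y) (Finsupp.mem_support_iff.2 h0)
        exact absurd this (by simpa using hy)
      rw [map_sub, map_smul, Finsupp.sub_apply, sub_eq_zero] at h1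
      exact h1
    have h0 := congrArg (fun m => b.repr m z) hl
    simp only [Finsupp.linearCombination_apply, Finsupp.sum, map_sum, map_smul, map_zero,
      Finsupp.coe_finsetSum, Finset.sum_apply, Finsupp.smul_apply, Finsupp.zero_apply] at h0
    rw [Finset.sum_eq_single z] at h0
    · rw [hrepr z le_rfl, b.repr_self, Finsupp.single_eq_same, mul_one, smul_eq_mul] at h0
      exact Finsupp.mem_support_iff.1 hz ((hc z).mul_left_eq_zero.1 h0)
    · intro y hy hyz
      rw [hrepr y (hmax y hy), b.repr_self, Finsupp.single_eq_of_ne hyz.symm, mul_zero, smul_zero]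
    · intro hz'; exact absurd hz hz'
  · rw [eq_top_iff, ← b.span_eq, Submodule.span_le]
    have key : ∀ n z, r z = n → b z ∈ Submodule.span R (Set.range f) := by
      intro n
      induction n using Nat.strong_induction_on with
      | _ n ih =>
      rintro z rfl
      have h1 : Submodule.span R (b '' {y | r y < r z}) ≤ Submodule.span R (Set.range f) := by
        rw [Submodule.span_le]
        rintro _ ⟨y, hy, rfl⟩
        exact ih _ hy y rfl
      have h2 : c z • b z ∈ Submodule.span R (Set.range f) := by
        have := sub_mem (Submodule.subset_span (Set.mem_range_self z)) (h1 (h z))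
        rwa [sub_sub_cancel] at this
      have h3 := Submodule.smul_mem _ ((hc z).unit⁻¹ : Rˣ).1 h2
      rwa [smul_smul, IsUnit.val_inv_mul, one_smul] at h3
    rintro _ ⟨z, rfl⟩
    exact key _ z rfl

/-- The triangular relation is transported, rather than the basis property, because the diagonal
becomes invertible only after base change. -/
theorem IsTriangular.baseChange (h : IsTriangular b r c f) (S : Type*) [CommRing S] [Algebra R S] :
    IsTriangular (b.baseChange S) r (fun z => algebraMap R S (c z))
      (fun z => (1 : S) ⊗ₜ[R] f z) := by
  have key : ∀ (s : Set ι) (m : N), m ∈ Submodule.span R (b '' s) →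
      (1 : S) ⊗ₜ[R] m ∈ Submodule.span S (b.baseChange S '' s) := by
    intro s m hm
    induction hm using Submodule.span_induction with
    | mem y hy =>
      obtain ⟨z, hz, rfl⟩ := hy
      exact Submodule.subset_span ⟨z, hz, b.baseChange_apply S z⟩
    | zero => rw [TensorProduct.tmul_zero]; exact zero_mem _
    | add y z _ _ hy hz => rw [TensorProduct.tmul_add]; exact add_mem hy hz
    | smul a y _ hy =>
      rw [TensorProduct.tmul_smul, ← algebraMap_smul S a]
      exact Submodule.smul_mem _ _ hy
  intro z
  have := key _ _ (h z)
  rwa [TensorProduct.tmul_sub, TensorProduct.tmul_smul, ← algebraMap_smul S (c z),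
    ← b.baseChange_apply S z] at this

end Triangular

/-! ### The integral basis of `M_𝒜` and the final base changes. -/

namespace CoxeterInvolution

open CoxeterSystem

variable {B : Type u} {W : Type v} [Group W] {M : CoxeterMatrix B} {cs : CoxeterSystem M W}
  {θ : CoxeterInvolution cs}

theorem linearIndependent_a : LinearIndependent (RatFunc ℚ) θ.a :=
  (Finsupp.basisSingleOne (R := RatFunc ℚ) (ι := θ.TwistedInv)).linearIndependent

variable (θ) in
/-- The basis `a_z` of `M_𝒜`. -/
noncomputable def basisMA : Module.Basis θ.TwistedInv ringA θ.MA :=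
  Module.Basis.span (linearIndependent_a.restrict_scalars
    (by intro x y h; simpa [Subring.smul_def] using h))

theorem basisMA_apply (z : θ.TwistedInv) : (θ.basisMA z : θ.Mu) = θ.a z :=
  congrArg Subtype.val (Module.Basis.span_apply _ z)

theorem uVar_add_one_mem : uVar + 1 ∈ ringA :=
  add_mem (Subring.subset_closure (by simp)) (one_mem _)

theorem coe_Ta_sub
    {ρ : HeckeAlgebra cs ((uVar : RatFunc ℚ) ^ 2) →ₐ[RatFunc ℚ] Module.End (RatFunc ℚ) θ.Mu}
    (hρ : θ.IsInvolutionModule ρ) (x : W) (n : ℕ) (z : θ.TwistedInv) :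
    ((hρ.Ta x - (⟨uVar + 1, uVar_add_one_mem⟩ : ringA) ^ n • θ.basisMA z : θ.MA) : θ.Mu) =
      ρ (HeckeAlgebra.T cs (uVar ^ 2) x) (θ.a θ.one) - ((uVar : RatFunc ℚ) + 1) ^ n • θ.a z := by
  rw [← basisMA_apply z]
  rfl

theorem exists_isTriangular {σ : θ.TwistedInv → List B} (hσ : ∀ z, θ.IsReducedExpr (σ z) z)
    {ρ : HeckeAlgebra cs ((uVar : RatFunc ℚ) ^ 2) →ₐ[RatFunc ℚ] Module.End (RatFunc ℚ) θ.Mu}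
    (hρ : θ.IsInvolutionModule ρ) :
    ∃ n : θ.TwistedInv → ℕ, IsTriangular θ.basisMA θ.rank
      (fun z => (⟨uVar + 1, uVar_add_one_mem⟩ : ringA) ^ n z)
      (fun z => hρ.Ta (cs.wordProd (σ z))) := by
  have key : ∀ z, ∃ n : ℕ, hρ.Ta (cs.wordProd (σ z)) -
      (⟨uVar + 1, uVar_add_one_mem⟩ : ringA) ^ n • θ.basisMA z ∈
      Submodule.span ringA (θ.basisMA '' {y | θ.rank y < θ.rank z}) := by
    intro z
    have hz := (hσ z).1
    have hlen : (σ z).length = θ.rank (θ.exprProd (σ z)) := by rw [hz, (hσ z).length_eq_rank]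
    obtain ⟨n, hn⟩ := exists_prod_heckeOp_apply hlen
    refine ⟨n, ?_⟩
    rw [hz] at hn
    rw [← hρ.map_wordProd (isReduced_of_length_eq_rank hlen)] at hn
    -- The relation is known in `M_u`; the injective inclusion of `M_𝒜` pulls it back.
    have himg : θ.a '' {y | θ.rank y < θ.rank z} =
        θ.MA.subtype '' (θ.basisMA '' {y | θ.rank y < θ.rank z}) := by
      rw [Set.image_image]
      exact Set.image_congr fun y _ => (basisMA_apply y).symm
    rw [himg, Submodule.span_image] at hn
    obtain ⟨m, hm, he⟩ := hn
    rwa [show m = _ from Subtype.ext (he.trans (coe_Ta_sub hρ _ n z).symm)] at hm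
  choose n hn using key
  exact ⟨n, hn⟩

theorem isUnit_uVar_add_one_of_mem {A : Subring (RatFunc ℚ)} (h : uVar + 1 ∈ A)
    (h' : (uVar + 1)⁻¹ ∈ A) : IsUnit (⟨uVar + 1, h⟩ : A) :=
  IsUnit.of_mul_eq_one ⟨_, h'⟩ (Subtype.ext (mul_inv_cancel₀ uVar_add_one_ne_zero))

end CoxeterInvolution

open CoxeterInvolution in
theorem corollary2p14 {B : Type u} {W : Type v} [Group W] {M : CoxeterMatrix B}
    (cs : CoxeterSystem M W) (θ : CoxeterInvolution cs)
    (σ : θ.TwistedInv → List B) (hσ : ∀ z, θ.IsReducedExpr (σ z) z) :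
    ∃ (ρ : HeckeAlgebra cs (uVar ^ 2) →ₐ[RatFunc ℚ] Module.End (RatFunc ℚ) θ.Mu)
      (hρ : θ.IsInvolutionModule ρ),
      (∀ ρ' : HeckeAlgebra cs (uVar ^ 2) →ₐ[RatFunc ℚ] Module.End (RatFunc ℚ) θ.Mu,
        θ.IsInvolutionModule ρ' → ρ' = ρ) ∧
      IsBasisFamily ringAneg
        (fun z : θ.TwistedInv =>
          ((1 : ringAneg) ⊗ₜ[ringA] hρ.Ta (cs.wordProd (σ z)) : ringAneg ⊗[ringA] θ.MA)) ∧
      IsBasisFamily ringApm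
        (fun z : θ.TwistedInv =>
          ((1 : ringApm) ⊗ₜ[ringA] hρ.Ta (cs.wordProd (σ z)) : ringApm ⊗[ringA] θ.MA)) ∧
      IsBasisFamily (RatFunc ℚ)
        (fun z : θ.TwistedInv =>
          ρ (HeckeAlgebra.T cs (uVar ^ 2) (cs.wordProd (σ z))) (θ.a θ.one)) ∧
      ∀ (K : Type w) [Field K] [Algebra ringAneg K],
        IsBasisFamily K
          (fun z : θ.TwistedInv =>
            ((1 : K) ⊗ₜ[ringAneg] ((1 : ringAneg) ⊗ₜ[ringA] hρ.Ta (cs.wordProd (σ z))) :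
              K ⊗[ringAneg] (ringAneg ⊗[ringA] θ.MA))) := by
  have hρ := heckeRep_isInvolutionModule (θ := θ)
  obtain ⟨n, hn⟩ := exists_isTriangular hσ hρ
  have hneg : ∀ z, IsUnit (algebraMap ringA ringAneg
      ((⟨uVar + 1, uVar_add_one_mem⟩ : ringA) ^ n z)) := by
    intro z
    rw [map_pow]
    exact (isUnit_uVar_add_one_of_mem (ringA_le_ringAneg uVar_add_one_mem)
      (Subring.subset_closure (by simp))).pow _
  have hpm : ∀ z, IsUnit (algebraMap ringA ringApm
      ((⟨uVar + 1, uVar_add_one_mem⟩ : ringA) ^ n z)) := by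
    intro z
    rw [map_pow]
    exact (isUnit_uVar_add_one_of_mem (ringA_le_ringApm uVar_add_one_mem)
      (Subring.subset_closure (by simp))).pow _
  -- For `K` the base change is iterated: `u + 1` is already a unit in `ringAneg`, so its image in
  -- `K` is a unit.
  refine ⟨θ.heckeRep, hρ, fun ρ' hρ' => hρ'.eq hρ, (hn.baseChange ringAneg).isBasisFamily hneg,
    (hn.baseChange ringApm).isBasisFamily hpm, ?_, fun K _ _ =>
      ((hn.baseChange ringAneg).baseChange K).isBasisFamily fun z => (hneg z).map _⟩
  have ht : IsTriangular (Finsupp.basisSingleOne (R := RatFunc ℚ) (ι := θ.TwistedInv)) θ.rank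
      (fun z => ((uVar : RatFunc ℚ) + 1) ^ n z)
      (fun z => θ.heckeRep (HeckeAlgebra.T cs (uVar ^ 2) (cs.wordProd (σ z))) (θ.a θ.one)) := by
    intro z
    have h1 := Submodule.mem_map_of_mem (f := θ.MA.subtype) (hn z)
    rw [← Submodule.span_image, Set.image_image] at h1
    simp only [Submodule.subtype_apply, basisMA_apply] at h1
    -- Over `ℚ(u)` no tensor product is needed: the integral span lies in the span over the field.
    have h2 := Submodule.span_le_restrictScalars ringA (RatFunc ℚ) _ h1
    rw [Submodule.restrictScalars_mem, coe_Ta_sub] at h2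
    rw [Finsupp.coe_basisSingleOne]
    exact h2
  exact ht.isBasisFamily fun z => (isUnit_iff_ne_zero.2 uVar_add_one_ne_zero).pow _
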